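/- Let ${\bf k}$ be a field of characteristic zero. A (nonunital) operad $\mathcal S$ is a sequence $\mathcal S(n)$, $n\ge 1$, of $\mathbb Z$-graded ${\bf k}$-vector spaces with degree-preserving left actions of the symmetric groups $\Sigma_n$ and degree zero bilinear operations $\circ_i:\mathcal S(m)\otimes\mathcal S(n)\to\mathcal S(m+n-1)$, $1\le i\le n$ (where $f\circ_i g$ plugs $f$ into the $i$-th input of $g$), that are associative, i.e. for $f\in\mathcal S(a)$, $g\in\mathcal S(b)$, $h\in\mathcal S(c)$ (homogeneous in the first and third case) $$f\circ_i(g\circ_j h)=\begin{cases}(-1)^{|f||g|}\,g\circ_{j+a-1}(f\circ_i h), & 1\le i\le j-1,\\ (f\circ_{i-j+1}g)\circ_j h, & j\le i\le b+j-1,\\ (-1)^{|f||g|}\,g\circ_j(f\circ_{i-b+1}h), & i\ge j+b,\end{cases}$$ and equivariant, i.e. $(\sigma f)\circ_{\tau(i)}(\tau g)=(\sigma\circ_i\tau)(f\circ_i g)$, where $\sigma\circ_i\tau\in\Sigma_{m+n-1}$ is obtained by inserting $\sigma$ at the $i$-th place of $\tau$. A collection is a sequence $E(n)$, $n\ge 2$,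 of graded vector spaces with degree-preserving $\Sigma_n$-actions; $\mathcal F(E)$ denotes the free operad on $E$, and $\mathcal F^{\ge 2}(E)\subset\mathcal F(E)$ the part spanned by the words with at least two letters from $E$. A differential $d$ on an operad is a family of equivariant linear maps of degree $-1$ with $d^2=0$ and $d(f\circ_i g)=df\circ_i g+(-1)^{|f|}f\circ_i dg$; then $\mathcal H(\mathcal S,d)$ denotes the homology operad. If a collection decomposes into subcollections as $Z=Z^0\oplus Z^1\oplus\cdots$, let $\mathcal F(Z)^k$ be the subspace of $\mathcal F(Z)$ spanned by the words in letters from $Z^{k_1},Z^{k_2},\dots$ with $k_1+k_2+\cdots=k$ (TJ-degree $k$). If $d$ is a differential on $\mathcal F(Z)$ that lowers the TJ-degree by one, $\mathcal H^k(\mathcal F(Z),d)$ denotes the part of $\mathcal H(\mathcal F(Z),d)$ represented by cycles in $\mathcal F(Z)^k$. **Theorem.** Let $\mathcal H$ be an operad with $\mathcal H(1)=0$. Then there exist a collection $Z=Z^0\oplus Z^1\oplus\cdots$, a differential $d$ on $\mathcal F(Z)$ with $d(Z^0)=0$ and $d(Z^k)\subset\mathcal F(Z)^{k-1}$ for all $k\ge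 1$, and a homomorphism $\rho:(\mathcal F(Z),d)\to(\mathcal H,0)$ of differential operads such that 1. $d$ is minimal: $d(Z)\subset\mathcal F^{\ge 2}(Z)$; 2. $\rho$ vanishes on $Z^k$ for all $k\ge 1$, and $\rho$ induces an isomorphism $\mathcal H^0(\mathcal F(Z),d)\cong\mathcal H$; 3. $\mathcal H^k(\mathcal F(Z),d)=0$ for all $k\ge 1$. -/

import Mathlib

universe u v w

open Equiv

/-! ### Graded modules -/

/-- A family of submodules admitting compatible projections, and spanning, is a direct sum
decomposition. -/
theorem isInternal_of_projections {k : Type u} [Field k] {M : Type v} [AddCommGroup M]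
    [Module k M] (A : ℤ → Submodule k M) (htop : ⨆ j, A j = ⊤) (π : ℤ → M →ₗ[k] M)
    (hsame : ∀ j, ∀ x ∈ A j, π j x = x) (hne : ∀ i j, i ≠ j → ∀ x ∈ A i, π j x = 0) :
    DirectSum.IsInternal A := by
  apply DirectSum.isInternal_submodule_of_iSupIndep_of_iSup_eq_top _ htop
  intro j
  rw [Submodule.disjoint_def]
  intro x hx hx'
  have : (⨆ i, ⨆ (_ : i ≠ j), A i) ≤ LinearMap.ker (π j) := by
    refine iSup_le fun i => iSup_le fun hi => fun y hy => ?_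
    exact hne i j hi y hy
  rw [← hsame j x hx]
  exact this hx'

/-- The sign `(-1)^e` as a scalar. -/
def koszulSign (k : Type u) [Field k] (e : ℤ) : k := ((e.negOnePow : ℤ) : k)

/-! ### Sequences of graded representations of the symmetric groups -/

/-- A sequence, indexed by the arity `n`, of `ℤ`-graded `k`-vector spaces `V n = ⨁ j, deg n j`
(the grading by `j` is the inner grading), each with a degree-preserving linear left action of the
symmetric group on `n` letters. -/
structure SymSeq (k : Type u) [Field k] where
  V : ℕ → Type v
  [addCommGroup : ∀ n, AddCommGroup (V n)]
  [module : ∀ n, Module k (V n)]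
  act : ∀ n, Perm (Fin n) →* Module.End k (V n)
  deg : ∀ n, ℤ → Submodule k (V n)
  isInternal : ∀ n, DirectSum.IsInternal (deg n)
  act_mem : ∀ {n} (σ : Perm (Fin n)) {j : ℤ} {x : V n}, x ∈ deg n j → act n σ x ∈ deg n j

attribute [instance] SymSeq.addCommGroup SymSeq.module

namespace SymSeq

variable {k : Type u} [Field k] (S : SymSeq.{u, v} k)

/-- Projection onto the homogeneous component of degree `j`. -/
noncomputable def proj (n : ℕ) (j : ℤ) : S.V n →ₗ[k] S.V n :=
  (S.deg n j).subtype ∘ₗ DirectSum.component k ℤ (fun i => S.deg n i) j ∘ₗ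
    (LinearEquiv.ofBijective (DirectSum.coeLinearMap (S.deg n)) (S.isInternal n)).symm.toLinearMap

theorem proj_mem (n : ℕ) (j : ℤ) (x : S.V n) : S.proj n j x ∈ S.deg n j :=
  Submodule.coe_mem _

theorem proj_of_mem {n : ℕ} {i : ℤ} (j : ℤ) {x : S.V n} (hx : x ∈ S.deg n i) :
    S.proj n j x = if i = j then x else 0 := by
  have : (LinearEquiv.ofBijective (DirectSum.coeLinearMap (S.deg n)) (S.isInternal n)).symm x
      = DirectSum.lof k ℤ (fun i => S.deg n i) i ⟨x, hx⟩ := by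
    rw [LinearEquiv.symm_apply_eq]
    exact (DirectSum.coeLinearMap_lof (S.deg n) i ⟨x, hx⟩).symm
  simp only [proj, LinearMap.comp_apply, LinearEquiv.coe_coe, this]
  by_cases h : i = j
  · subst h
    simp [DirectSum.component.lof_self]
  · rw [DirectSum.component.of]
    simp [h]

theorem iSup_deg (n : ℕ) : ⨆ j, S.deg n j = ⊤ := (S.isInternal n).submodule_iSup_eq_top

/-- Every element lies in any submodule containing all its homogeneous components. -/
theorem mem_of_proj_mem {n : ℕ} (W : Submodule k (S.V n)) (x : S.V n)
    (h : ∀ j, S.proj n j x ∈ W) : x ∈ W := by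
  classical
  set e := LinearEquiv.ofBijective (DirectSum.coeLinearMap (S.deg n)) (S.isInternal n) with he
  have hx : DirectSum.coeLinearMap (S.deg n) (e.symm x) = x := e.apply_symm_apply x
  have h' : ∀ j, ((e.symm x) j : S.V n) ∈ W := h
  rw [← hx, DirectSum.coeLinearMap_eq_dfinsuppSum]
  exact Submodule.sum_mem _ fun j _ => h' j

end SymSeq

/-- A collection: arities `n ≥ 2` only. -/
structure Collection (k : Type u) [Field k] extends SymSeq.{u, v} k where
  subsingleton_of_lt_two : ∀ n, n < 2 → Subsingleton (V n)

/-! ### Operads -/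

/-- The inputs of the composite of an operation with `m` inputs, plugged into the `i`-th input of
an operation with `n` inputs. -/
def inputPos {m n p : ℕ} (h : p + 1 = m + n) (i : Fin n) :
    Fin m ⊕ {b : Fin n // b ≠ i} → Fin p
  | .inl a => ⟨i + a, by omega⟩
  | .inr b => if hb : b.1 < i then ⟨b.1, by omega⟩ else
      ⟨b.1 + m - 1, by have := b.2; have : b.1.1 ≠ i.1 := fun e => this (Fin.ext e); omega⟩

theorem inputPos_bijective {m n p : ℕ} (h : p + 1 = m + n) (i : Fin n) :
    Function.Bijective (inputPos h i) := by
  rw [Fintype.bijective_iff_injective_and_card]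
  constructor
  · rintro (a | ⟨b, hb⟩) (a' | ⟨b', hb'⟩) hab
    · simp only [inputPos, Fin.mk.injEq] at hab
      congr 1
      ext
      omega
    · exfalso
      have : b'.1 ≠ i.1 := fun e => hb' (Fin.ext e)
      simp only [inputPos] at hab
      split_ifs at hab with h1 <;> simp only [Fin.mk.injEq] at hab <;>
        simp only [Fin.lt_def] at h1 <;> omega
    · exfalso
      have : b.1 ≠ i.1 := fun e => hb (Fin.ext e)
      simp only [inputPos] at hab
      split_ifs at hab with h1 <;> simp only [Fin.mk.injEq] at hab <;>
        simp only [Fin.lt_def] at h1 <;> omega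
    · have : b.1 ≠ i.1 := fun e => hb (Fin.ext e)
      have : b'.1 ≠ i.1 := fun e => hb' (Fin.ext e)
      simp only [inputPos] at hab
      congr 2
      ext
      split_ifs at hab with h1 h2 h2 <;> simp only [Fin.mk.injEq] at hab <;>
        simp only [Fin.lt_def] at h1 h2 <;> omega
  · have := i.2
    simp only [Fintype.card_sum, Fintype.card_fin, Fintype.card_subtype_compl,
      Fintype.card_unique, ne_eq]
    omega

/-- `inputPos` as a bijection. -/
noncomputable def inputEquiv {m n p : ℕ} (h : p + 1 = m + n) (i : Fin n) :
    Fin m ⊕ {b : Fin n // b ≠ i} ≃ Fin p :=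
  Equiv.ofBijective _ (inputPos_bijective h i)

/-- The permutation obtained by inserting `σ` into `τ`: it sends the inputs of the composite at
the place `j` to the inputs of the composite at the place `τ j`, by `σ` on the inputs of the
inserted operation, and by `τ` on the other ones. -/
noncomputable def insertPerm {m n p : ℕ} (h : p + 1 = m + n) (σ : Perm (Fin m))
    (τ : Perm (Fin n)) (j : Fin n) : Perm (Fin p) :=
  (inputEquiv h j).symm.trans
    ((Equiv.sumCongr σ (τ.subtypeEquiv fun b => not_congr (τ.apply_eq_iff_eq (x := b) (y := j)).symm)).trans
      (inputEquiv h (τ j)))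

/-- A (nonunital, graded, symmetric) operad, given by partial compositions. Arities are `n ≥ 1`
(the arity `0` component is zero). The element `comp h i f g`, also written `f ∘ᵢ g`, is the
composite in which the output of `f`, of arity `m`, is plugged into the `i`-th input of `g`, of
arity `n`; its arity is `p = m + n - 1`. Inputs are numbered from `0`. -/
structure Operad (k : Type u) [Field k] extends SymSeq.{u, v} k where
  subsingleton_zero : Subsingleton (V 0)
  comp : ∀ {m n p : ℕ}, p + 1 = m + n → Fin n → (V m →ₗ[k] V n →ₗ[k] V p)
  comp_mem : ∀ {m n p : ℕ} (h : p + 1 = m + n) (i : Fin n) {s t : ℤ} {f : V m} {g : V n},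
    f ∈ deg m s → g ∈ deg n t → comp h i f g ∈ deg p (s + t)
  /-- Associativity, `f` being plugged into one of the inputs of `g`. -/
  comp_seq : ∀ {a b c q r p : ℕ} (h₁ : q + 1 = b + c) (h₂ : p + 1 = a + q) (h₃ : r + 1 = a + b)
    (h₄ : p + 1 = r + c) (i : Fin b) (j : Fin c) (f : V a) (g : V b) (x : V c),
    comp h₂ ⟨j + i, by omega⟩ f (comp h₁ j g x) = comp h₄ j (comp h₃ i f g) x
  /-- Associativity, `f` and `g` being plugged into two inputs `i < j` of `x`. (Read from right
  to left, with `f` and `g` exchanged, this is also the case `i > j`.) -/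
  comp_par : ∀ {a b c q r p : ℕ} (h₁ : q + 1 = b + c) (h₂ : p + 1 = a + q) (h₃ : r + 1 = a + c)
    (h₄ : p + 1 = b + r) (i j : Fin c) (hij : i < j) {s t : ℤ} {f : V a} {g : V b} (x : V c),
    f ∈ deg a s → g ∈ deg b t →
    comp h₂ ⟨i, by omega⟩ f (comp h₁ j g x) =
      koszulSign k (s * t) • comp h₄ ⟨j + a - 1, by omega⟩ g (comp h₃ i f x)
  /-- Equivariance. -/
  comp_act : ∀ {m n p : ℕ} (h : p + 1 = m + n) (j : Fin n) (σ : Perm (Fin m))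
    (τ : Perm (Fin n)) (f : V m) (g : V n),
    comp h (τ j) (act m σ f) (act n τ g) = act p (insertPerm h σ τ j) (comp h j f g)

namespace Operad

variable {k : Type u} [Field k]

/-- A homomorphism of operads: degree zero equivariant linear maps that preserve the partial
compositions. -/
structure Hom (S : Operad.{u, v} k) (T : Operad.{u, w} k) where
  map : ∀ n, S.V n →ₗ[k] T.V n
  map_mem : ∀ {n : ℕ} {j : ℤ} {x : S.V n}, x ∈ S.deg n j → map n x ∈ T.deg n j
  map_act : ∀ {n : ℕ} (σ : Perm (Fin n)) (x : S.V n), map n (S.act n σ x) = T.act n σ (map n x)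
  map_comp : ∀ {m n p : ℕ} (h : p + 1 = m + n) (i : Fin n) (f : S.V m) (g : S.V n),
    map p (S.comp h i f g) = T.comp h i (map m f) (map n g)

/-- A degree `e` derivation of an operad. -/
structure Derivation (S : Operad.{u, v} k) (e : ℤ) where
  map : ∀ n, S.V n →ₗ[k] S.V n
  map_mem : ∀ {n : ℕ} {j : ℤ} {x : S.V n}, x ∈ S.deg n j → map n x ∈ S.deg n (j + e)
  map_act : ∀ {n : ℕ} (σ : Perm (Fin n)) (x : S.V n), map n (S.act n σ x) = S.act n σ (map n x)
  leibniz : ∀ {m n p : ℕ} (h : p + 1 = m + n) (i : Fin n) {s : ℤ} {f : S.V m} (g : S.V n),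
    f ∈ S.deg m s →
    map p (S.comp h i f g) =
      S.comp h i (map m f) g + koszulSign k (e * s) • S.comp h i f (map n g)

/-- A differential on an operad: a degree `-1` derivation of square zero. -/
structure Differential (S : Operad.{u, v} k) extends Derivation S (-1) where
  map_map : ∀ (n : ℕ) (x : S.V n), map n (map n x) = 0

/-- The trivial differential. -/
def zeroDifferential (S : Operad.{u, v} k) : Differential S where
  map _ := 0
  map_mem _ := Submodule.zero_mem _
  map_act _ _ := by simp
  leibniz _ _ _ _ _ _ := by simp
  map_map _ _ := rfl

/-- `φ` is a homomorphism of differential operads `(S, d) → (T, d')`. -/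
def Hom.Commutes {S : Operad.{u, v} k} {T : Operad.{u, w} k} (φ : Hom S T) (d : Differential S)
    (d' : Differential T) : Prop :=
  ∀ (n : ℕ) (x : S.V n), φ.map n (d.map n x) = d'.map n (φ.map n x)

end Operad

/-! ### The free operad on a collection -/

/-- Formal operadic words in homogeneous elements of a collection. -/
inductive Word {k : Type u} [Field k] (E : Collection.{u, v} k) : ℕ → Type v
  | gen {n : ℕ} (j : ℤ) (z : E.deg n j) : Word E n
  | act {n : ℕ} (σ : Perm (Fin n)) (t : Word E n) : Word E n
  | comp {m n p : ℕ} (h : p + 1 = m + n) (i : Fin n) (s : Word E m) (t : Word E n) : Word E p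

namespace Word

variable {k : Type u} [Field k] {E : Collection.{u, v} k}

/-- Inner degree of a word: the sum of the degrees of its letters. -/
def deg : ∀ {n : ℕ}, Word E n → ℤ
  | _, gen j _ => j
  | _, act _ t => t.deg
  | _, comp _ _ s t => s.deg + t.deg

/-- Length of a word: its number of letters. -/
def length : ∀ {n : ℕ}, Word E n → ℕ
  | _, gen _ _ => 1
  | _, act _ t => t.length
  | _, comp _ _ s t => s.length + t.length

/-- The action of a permutation on formal linear combinations of words. -/
noncomputable def actLin {n : ℕ} (σ : Perm (Fin n)) : (Word E n →₀ k) →ₗ[k] (Word E n →₀ k) :=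
  Finsupp.lmapDomain k k (act σ)

/-- The bilinear extension of the composition of words. -/
noncomputable def compLin {m n p : ℕ} (h : p + 1 = m + n) (i : Fin n) :
    (Word E m →₀ k) →ₗ[k] (Word E n →₀ k) →ₗ[k] (Word E p →₀ k) :=
  Finsupp.linearCombination k fun s => Finsupp.lmapDomain k k (comp h i s)

/-- A word as a formal linear combination. -/
noncomputable abbrev single {n : ℕ} (t : Word E n) : Word E n →₀ k := Finsupp.single t 1

/-- The linear combinations of words that vanish in the free operad: the smallest family of
subspaces, closed under the symmetric group actions and under composition with words, that
contains the relations between the letters and the operad axioms. -/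
inductive Rel : ∀ {n : ℕ}, (Word E n →₀ k) → Prop
  | zero {n : ℕ} : Rel (0 : Word E n →₀ k)
  | add {n : ℕ} {x y : Word E n →₀ k} : Rel x → Rel y → Rel (x + y)
  | smul {n : ℕ} (c : k) {x : Word E n →₀ k} : Rel x → Rel (c • x)
  | act {n : ℕ} (σ : Perm (Fin n)) {x : Word E n →₀ k} : Rel x → Rel (actLin σ x)
  | comp_left {m n p : ℕ} (h : p + 1 = m + n) (i : Fin n) {x : Word E m →₀ k} (t : Word E n) :
      Rel x → Rel (compLin h i x (single t))
  | comp_right {m n p : ℕ} (h : p + 1 = m + n) (i : Fin n) (s : Word E m) {y : Word E n →₀ k} :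
      Rel y → Rel (compLin h i (single s) y)
  | gen_add {n : ℕ} (j : ℤ) (z z' : E.deg n j) :
      Rel (single (gen j (z + z')) - single (gen j z) - single (gen j z'))
  | gen_smul {n : ℕ} (j : ℤ) (c : k) (z : E.deg n j) :
      Rel (single (gen j (c • z)) - c • single (gen j z))
  | gen_act {n : ℕ} (j : ℤ) (σ : Perm (Fin n)) (z : E.deg n j) :
      Rel (single (Word.act σ (gen j z)) - single (gen j ⟨E.act n σ z, E.act_mem σ z.2⟩))
  | act_one {n : ℕ} (t : Word E n) : Rel (single (Word.act 1 t) - single t)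
  | act_mul {n : ℕ} (σ τ : Perm (Fin n)) (t : Word E n) :
      Rel (single (Word.act (σ * τ) t) - single (Word.act σ (Word.act τ t)))
  | comp_seq {a b c q r p : ℕ} (h₁ : q + 1 = b + c) (h₂ : p + 1 = a + q) (h₃ : r + 1 = a + b)
      (h₄ : p + 1 = r + c) (i : Fin b) (j : Fin c) (s : Word E a) (t : Word E b) (x : Word E c) :
      Rel (single (comp h₂ ⟨j + i, by omega⟩ s (comp h₁ j t x)) -
        single (comp h₄ j (comp h₃ i s t) x))
  | comp_par {a b c q r p : ℕ} (h₁ : q + 1 = b + c) (h₂ : p + 1 = a + q) (h₃ : r + 1 = a + c)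
      (h₄ : p + 1 = b + r) (i j : Fin c) (hij : i < j) (s : Word E a) (t : Word E b)
      (x : Word E c) :
      Rel (single (comp h₂ ⟨i, by omega⟩ s (comp h₁ j t x)) -
        koszulSign k (s.deg * t.deg) • single (comp h₄ ⟨j + a - 1, by omega⟩ t (comp h₃ i s x)))
  | comp_act {m n p : ℕ} (h : p + 1 = m + n) (j : Fin n) (σ : Perm (Fin m)) (τ : Perm (Fin n))
      (s : Word E m) (t : Word E n) :
      Rel (single (comp h (τ j) (Word.act σ s) (Word.act τ t)) -
        single (Word.act (insertPerm h σ τ j) (comp h j s t)))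

variable (E) in
/-- The relations of arity `n`, as a subspace. -/
def relSubmodule (n : ℕ) : Submodule k (Word E n →₀ k) where
  carrier := {x | Rel x}
  zero_mem' := Rel.zero
  add_mem' := Rel.add
  smul_mem' c _ := Rel.smul c

@[simp] theorem actLin_single {n : ℕ} (σ : Perm (Fin n)) (t : Word E n) :
    actLin σ (single t) = single (act σ t) := by
  simp [actLin]

@[simp] theorem compLin_single {m n p : ℕ} (h : p + 1 = m + n) (i : Fin n) (s : Word E m)
    (t : Word E n) : compLin h i (single s) (single t) = single (comp h i s t) := by
  simp [compLin]

/-- Two linear combinations agree if a linear identity holds on words. -/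
theorem linear_induction {n : ℕ} {P : (Word E n →₀ k) → Prop} (x : Word E n →₀ k) (h0 : P 0)
    (hadd : ∀ x y, P x → P y → P (x + y)) (hsmul : ∀ (c : k) x, P x → P (c • x))
    (hw : ∀ t, P (single t)) : P x := by
  induction x using Finsupp.induction_linear with
  | zero => exact h0
  | add f g hf hg => exact hadd f g hf hg
  | single a b =>
    have := hsmul b _ (hw a)
    rwa [Finsupp.smul_single, smul_eq_mul, mul_one] at this

theorem compLin_rel_left {m n p : ℕ} (h : p + 1 = m + n) (i : Fin n) {x : Word E m →₀ k}
    (hx : Rel x) (y : Word E n →₀ k) : Rel (compLin h i x y) := by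
  refine linear_induction (P := fun y => Rel (compLin h i x y)) y ?_ ?_ ?_ ?_
  · rw [map_zero]; exact Rel.zero
  · intro a b ha hb; rw [map_add]; exact Rel.add ha hb
  · intro c a ha; rw [map_smul]; exact Rel.smul c ha
  · intro t; exact Rel.comp_left h i t hx

theorem compLin_rel_right {m n p : ℕ} (h : p + 1 = m + n) (i : Fin n) (x : Word E m →₀ k)
    {y : Word E n →₀ k} (hy : Rel y) : Rel (compLin h i x y) := by
  refine linear_induction (P := fun x => Rel (compLin h i x y)) x ?_ ?_ ?_ ?_
  · rw [map_zero]; exact Rel.zero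
  · intro a b ha hb; rw [map_add]; exact Rel.add ha hb
  · intro c a ha; rw [map_smul]; exact Rel.smul c ha
  · intro t; exact Rel.comp_right h i t hy

/-- Projection of formal linear combinations onto the words of degree `e`. -/
noncomputable def projLin {n : ℕ} (e : ℤ) : (Word E n →₀ k) →ₗ[k] (Word E n →₀ k) :=
  Finsupp.linearCombination k fun t => if t.deg = e then single t else 0

theorem projLin_single {n : ℕ} (e : ℤ) (t : Word E n) :
    projLin e (single (k := k) t) = if t.deg = e then single t else 0 := by
  simp [projLin]

theorem projLin_actLin {n : ℕ} (e : ℤ) (σ : Perm (Fin n)) (x : Word E n →₀ k) :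
    projLin e (actLin σ x) = actLin σ (projLin e x) := by
  refine linear_induction (P := fun x => projLin e (actLin σ x) = actLin σ (projLin e x)) x
    (by simp) ?_ ?_ ?_
  · intro a b ha hb; simp only [map_add, ha, hb]
  · intro c a ha; simp only [map_smul, ha]
  · intro t
    rw [actLin_single, projLin_single, projLin_single, deg]
    split_ifs <;> simp

theorem projLin_comp_left {m n p : ℕ} (h : p + 1 = m + n) (i : Fin n) (e : ℤ)
    (x : Word E m →₀ k) (t : Word E n) :
    projLin e (compLin h i x (single t)) = compLin h i (projLin (e - t.deg) x) (single t) := by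
  refine linear_induction (P := fun x => projLin e (compLin h i x (single t)) =
    compLin h i (projLin (e - t.deg) x) (single t)) x (by simp) ?_ ?_ ?_
  · intro a b ha hb; simp only [map_add, LinearMap.add_apply, ha, hb]
  · intro c a ha; simp only [map_smul, LinearMap.smul_apply, ha]
  · intro s
    rw [compLin_single, projLin_single, projLin_single, deg]
    by_cases hs : s.deg + t.deg = e
    · rw [if_pos hs, if_pos (by omega), compLin_single]
    · rw [if_neg hs, if_neg (by omega)]; simp

theorem projLin_comp_right {m n p : ℕ} (h : p + 1 = m + n) (i : Fin n) (e : ℤ)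
    (s : Word E m) (y : Word E n →₀ k) :
    projLin e (compLin h i (single s) y) = compLin h i (single s) (projLin (e - s.deg) y) := by
  refine linear_induction (P := fun y => projLin e (compLin h i (single s) y) =
    compLin h i (single s) (projLin (e - s.deg) y)) y (by simp) ?_ ?_ ?_
  · intro a b ha hb; simp only [map_add, ha, hb]
  · intro c a ha; simp only [map_smul, ha]
  · intro t
    rw [compLin_single, projLin_single, projLin_single, deg]
    by_cases hs : s.deg + t.deg = e
    · rw [if_pos hs, if_pos (by omega), compLin_single]
    · rw [if_neg hs, if_neg (by omega)]; simp

/-- The relations are homogeneous. -/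
theorem projLin_rel {n : ℕ} {x : Word E n →₀ k} (hx : Rel x) : ∀ e, Rel (projLin e x) := by
  have two : ∀ {n : ℕ} (s t : Word E n) (c : k) (e : ℤ), s.deg = t.deg →
      Rel (single s - c • single t) → Rel (projLin e (single s - c • single t)) := by
    intro n s t c e hst hr
    rw [map_sub, map_smul, projLin_single, projLin_single, hst]
    split_ifs
    · exact hr
    · simpa using Rel.zero
  have two' : ∀ {n : ℕ} (s t : Word E n) (e : ℤ), s.deg = t.deg →
      Rel (single (k := k) s - single t) → Rel (projLin e (single (k := k) s - single t)) := by
    intro n s t e hst hr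
    have := two s t 1 e hst (by rwa [one_smul])
    rwa [one_smul] at this
  induction hx with
  | zero => intro e; rw [map_zero]; exact Rel.zero
  | add _ _ h1 h2 => intro e; rw [map_add]; exact Rel.add (h1 e) (h2 e)
  | smul c _ h1 => intro e; rw [map_smul]; exact Rel.smul c (h1 e)
  | act σ _ h1 => intro e; rw [projLin_actLin]; exact Rel.act σ (h1 e)
  | comp_left h i t hr h1 => intro e; rw [projLin_comp_left]; exact Rel.comp_left h i t (h1 _)
  | comp_right h i s hr h1 => intro e; rw [projLin_comp_right]; exact Rel.comp_right h i s (h1 _)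
  | @gen_add n' j z z' =>
    intro e
    rw [map_sub, map_sub, projLin_single, projLin_single, projLin_single]
    have hd : ∀ w : E.deg n' j, (gen j w : Word E n').deg = j := fun _ => by rw [deg]
    by_cases hj : j = e
    · rw [if_pos ((hd _).trans hj), if_pos ((hd _).trans hj), if_pos ((hd _).trans hj)]
      exact Rel.gen_add j z z'
    · rw [if_neg (fun hc => hj ((hd _).symm.trans hc)), if_neg (fun hc => hj ((hd _).symm.trans hc)),
        if_neg (fun hc => hj ((hd _).symm.trans hc)), sub_zero, sub_zero]
      exact Rel.zero
  | gen_smul j c z => exact fun e => two _ _ _ e rfl (Rel.gen_smul j c z)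
  | gen_act j σ z => exact fun e => two' _ _ e rfl (Rel.gen_act j σ z)
  | act_one t => exact fun e => two' _ _ e rfl (Rel.act_one t)
  | act_mul σ τ t => exact fun e => two' _ _ e rfl (Rel.act_mul σ τ t)
  | comp_seq h₁ h₂ h₃ h₄ i j s t x =>
    exact fun e => two' _ _ e (by simp only [deg]; ring) (Rel.comp_seq h₁ h₂ h₃ h₄ i j s t x)
  | comp_par h₁ h₂ h₃ h₄ i j hij s t x =>
    exact fun e => two _ _ _ e (by simp only [deg]; ring) (Rel.comp_par h₁ h₂ h₃ h₄ i j hij s t x)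
  | comp_act h j σ τ s t => exact fun e => two' _ _ e rfl (Rel.comp_act h j σ τ s t)

end Word

namespace FreeOperad

variable {k : Type u} [Field k] (E : Collection.{u, v} k)

open Word

/-- The underlying vector spaces of the free operad. -/
abbrev Carrier (n : ℕ) : Type (max u v) := (Word E n →₀ k) ⧸ relSubmodule E n

variable {E}

/-- The class of a word in the free operad. -/
noncomputable def mk {n : ℕ} (t : Word E n) : Carrier E n := (relSubmodule E n).mkQ (single t)

theorem mk_eq_of_rel {n : ℕ} (s t : Word E n) (c : k) (h : Rel (single s - c • single t)) :
    mk s = c • mk t := by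
  rw [mk, mk, ← map_smul]
  exact (Submodule.Quotient.eq _).2 h

theorem mk_eq_of_rel_one {n : ℕ} (s t : Word E n) (h : Rel (single (k := k) s - single t)) :
    mk s = mk t :=
  (Submodule.Quotient.eq _).2 h

theorem induction {n : ℕ} {P : Carrier E n → Prop} (x : Carrier E n) (h0 : P 0)
    (hadd : ∀ x y, P x → P y → P (x + y)) (hsmul : ∀ (c : k) x, P x → P (c • x))
    (hw : ∀ t, P (mk t)) : P x := by
  obtain ⟨x, rfl⟩ := (relSubmodule E n).mkQ_surjective x
  refine linear_induction (P := fun x => P ((relSubmodule E n).mkQ x)) x ?_ ?_ ?_ hw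
  · rwa [map_zero]
  · intro a b ha hb; rw [map_add]; exact hadd _ _ ha hb
  · intro c a ha; rw [map_smul]; exact hsmul _ _ ha

/-- Linear maps from the free operad agree if they agree on words. -/
theorem hom_ext {n : ℕ} {M : Type w} [AddCommGroup M] [Module k M] {f g : Carrier E n →ₗ[k] M}
    (h : ∀ t, f (mk t) = g (mk t)) : f = g := by
  refine LinearMap.ext fun x => ?_
  refine induction (P := fun x => f x = g x) x (by simp) ?_ ?_ h
  · intro a b ha hb; rw [map_add, map_add, ha, hb]
  · intro c a ha; rw [map_smul, map_smul, ha]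

/-- The action of the symmetric group on the free operad. -/
noncomputable def actMap {n : ℕ} (σ : Perm (Fin n)) : Carrier E n →ₗ[k] Carrier E n :=
  (relSubmodule E n).mapQ (relSubmodule E n) (actLin σ) fun _ hx => Rel.act σ hx

@[simp] theorem actMap_mk {n : ℕ} (σ : Perm (Fin n)) (t : Word E n) :
    actMap σ (mk t) = mk (act σ t) := by
  change (relSubmodule E n).mkQ (actLin σ (single t)) = _
  rw [actLin_single, mk]

/-- The partial compositions of the free operad. -/
noncomputable def compMap {m n p : ℕ} (h : p + 1 = m + n) (i : Fin n) :
    Carrier E m →ₗ[k] Carrier E n →ₗ[k] Carrier E p :=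
  (relSubmodule E m).liftQ
    { toFun := fun x => (relSubmodule E n).mapQ (relSubmodule E p) (compLin h i x)
        fun _ hy => compLin_rel_right h i x hy
      map_add' := fun x y => by
        apply Submodule.linearMap_qext
        refine LinearMap.ext fun z => ?_
        change (relSubmodule E p).mkQ (compLin h i (x + y) z) =
          (relSubmodule E p).mkQ (compLin h i x z) + (relSubmodule E p).mkQ (compLin h i y z)
        rw [map_add, LinearMap.add_apply, map_add]
      map_smul' := fun c x => by
        apply Submodule.linearMap_qext
        refine LinearMap.ext fun z => ?_
        change (relSubmodule E p).mkQ (compLin h i (c • x) z) =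
          c • (relSubmodule E p).mkQ (compLin h i x z)
        rw [map_smul, LinearMap.smul_apply, map_smul] }
    (fun x hx => by
      apply Submodule.linearMap_qext
      refine LinearMap.ext fun z => ?_
      exact (Submodule.Quotient.mk_eq_zero _).2 (compLin_rel_left h i hx z))

@[simp] theorem compMap_mk {m n p : ℕ} (h : p + 1 = m + n) (i : Fin n) (s : Word E m)
    (t : Word E n) : compMap h i (mk s) (mk t) = mk (comp h i s t) := by
  simp only [mk, ← compLin_single]
  rfl

/-- The span of the words of degree `j`. -/
noncomputable def degSubmodule (n : ℕ) (j : ℤ) : Submodule k (Carrier E n) :=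
  Submodule.span k {x | ∃ t : Word E n, t.deg = j ∧ mk t = x}

theorem mk_mem {n : ℕ} (t : Word E n) : mk t ∈ degSubmodule n t.deg :=
  Submodule.subset_span ⟨t, rfl, rfl⟩

/-- Projection onto the component of degree `e`. -/
noncomputable def projMap {n : ℕ} (e : ℤ) : Carrier E n →ₗ[k] Carrier E n :=
  (relSubmodule E n).mapQ (relSubmodule E n) (projLin e) fun _ hx => projLin_rel hx e

theorem projMap_mk {n : ℕ} (e : ℤ) (t : Word E n) :
    projMap e (mk t) = if t.deg = e then mk t else 0 := by
  change (relSubmodule E n).mkQ (projLin e (single t)) = _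
  rw [projLin_single]
  split_ifs
  · rfl
  · exact map_zero _

theorem deg_isInternal (n : ℕ) : DirectSum.IsInternal (degSubmodule (E := E) n) := by
  refine isInternal_of_projections _ ?_ projMap ?_ ?_
  · rw [eq_top_iff]
    intro x _
    refine induction (P := fun x => x ∈ ⨆ j, degSubmodule n j) x (Submodule.zero_mem _)
      (fun _ _ => Submodule.add_mem _) (fun c _ => Submodule.smul_mem _ c) fun t => ?_
    exact Submodule.mem_iSup_of_mem t.deg (mk_mem t)
  · intro j x hx
    induction hx using Submodule.span_induction with
    | mem x hx =>
      obtain ⟨t, ht, rfl⟩ := hx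
      rw [projMap_mk, if_pos ht]
    | zero => simp
    | add x y _ _ hx hy => rw [map_add, hx, hy]
    | smul c x _ hx => rw [map_smul, hx]
  · intro i j hij x hx
    induction hx using Submodule.span_induction with
    | mem x hx =>
      obtain ⟨t, ht, rfl⟩ := hx
      rw [projMap_mk, if_neg (by rw [ht]; exact hij)]
    | zero => simp
    | add x y _ _ hx hy => rw [map_add, hx, hy, add_zero]
    | smul c x _ hx => rw [map_smul, hx, smul_zero]

theorem mk_eq_zero_of_arity_zero {n : ℕ} (t : Word E n) (hn : n = 0) : mk t = 0 := by
  induction t with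
  | @gen n j z =>
    have := E.subsingleton_of_lt_two n (by omega)
    have hz : z = (0 : k) • z := Subsingleton.elim _ _
    have := mk_eq_of_rel _ _ _ (Rel.gen_smul (E := E) j (0 : k) z)
    rw [zero_smul k (mk _), ← hz] at this
    exact this
  | act σ t ih => rw [← actMap_mk, ih hn, map_zero]
  | comp h i s t ihs iht =>
    have := i.2
    rw [← compMap_mk, ihs (by omega), map_zero, LinearMap.zero_apply]

end FreeOperad

open FreeOperad in
/-- The free operad on a collection: formal linear combinations of words modulo the relations. -/
noncomputable def freeOperad {k : Type u} [Field k] (E : Collection.{u, v} k) :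
    Operad.{u, max u v} k where
  V := Carrier E
  act n :=
    { toFun := actMap
      map_one' := hom_ext fun t => by
        rw [actMap_mk]
        exact mk_eq_of_rel_one _ _ (Word.Rel.act_one t)
      map_mul' := fun σ τ => hom_ext fun t => by
        rw [Module.End.mul_apply, actMap_mk, actMap_mk, actMap_mk]
        exact mk_eq_of_rel_one _ _ (Word.Rel.act_mul σ τ t) }
  deg := degSubmodule
  isInternal := deg_isInternal
  act_mem := by
    intro n σ j x hx
    induction hx using Submodule.span_induction with
    | mem x hx =>
      obtain ⟨t, rfl, rfl⟩ := hx
      exact (actMap_mk σ t).symm ▸ mk_mem (Word.act σ t)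
    | zero => rw [map_zero]; exact Submodule.zero_mem _
    | add x y _ _ hx hy => rw [map_add]; exact Submodule.add_mem _ hx hy
    | smul c x _ hx => rw [map_smul]; exact Submodule.smul_mem _ c hx
  subsingleton_zero := by
    refine subsingleton_of_forall_eq 0 fun x => ?_
    refine induction (P := fun x => x = 0) x rfl ?_ ?_ ?_
    · rintro a b rfl rfl; simp
    · rintro c a rfl; simp
    · exact fun t => mk_eq_zero_of_arity_zero t rfl
  comp := compMap
  comp_mem := by
    intro m n p h i s t f g hf hg
    induction hf using Submodule.span_induction with
    | mem f hf =>
      obtain ⟨f, rfl, rfl⟩ := hf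
      induction hg using Submodule.span_induction with
      | mem g hg =>
        obtain ⟨g, rfl, rfl⟩ := hg
        rw [compMap_mk]
        exact mk_mem (Word.comp h i f g)
      | zero => rw [map_zero]; exact Submodule.zero_mem _
      | add x y _ _ hx hy => rw [map_add]; exact Submodule.add_mem _ hx hy
      | smul c x _ hx => rw [map_smul]; exact Submodule.smul_mem _ c hx
    | zero => rw [map_zero]; exact Submodule.zero_mem _
    | add x y _ _ hx hy => rw [map_add]; exact Submodule.add_mem _ hx hy
    | smul c x _ hx => rw [map_smul]; exact Submodule.smul_mem _ c hx
  comp_seq := by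
    intro a b c q r p h₁ h₂ h₃ h₄ i j f g x
    refine induction (P := fun f => compMap h₂ ⟨j + i, by omega⟩ f (compMap h₁ j g x) =
      compMap h₄ j (compMap h₃ i f g) x) f (by simp) ?_ ?_ fun f => ?_
    · intro a b ha hb; simp only [map_add, LinearMap.add_apply, ha, hb]
    · intro c a ha; simp only [map_smul, LinearMap.smul_apply, ha]
    refine induction (P := fun g => compMap h₂ ⟨j + i, by omega⟩ (mk f) (compMap h₁ j g x) =
      compMap h₄ j (compMap h₃ i (mk f) g) x) g (by simp) ?_ ?_ fun g => ?_
    · intro a b ha hb; simp only [map_add, LinearMap.add_apply, ha, hb]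
    · intro c a ha; simp only [map_smul, LinearMap.smul_apply, ha]
    refine induction (P := fun x => compMap h₂ ⟨j + i, by omega⟩ (mk f) (compMap h₁ j (mk g) x) =
      compMap h₄ j (compMap h₃ i (mk f) (mk g)) x) x (by simp) ?_ ?_ fun x => ?_
    · intro a b ha hb; simp only [map_add, ha, hb]
    · intro c a ha; simp only [map_smul, ha]
    simp only [compMap_mk]
    exact mk_eq_of_rel_one _ _ (Word.Rel.comp_seq h₁ h₂ h₃ h₄ i j f g x)
  comp_par := by
    intro a b c q r p h₁ h₂ h₃ h₄ i j hij s t f g x hf hg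
    induction hf using Submodule.span_induction with
    | mem f hf =>
      obtain ⟨f, rfl, rfl⟩ := hf
      induction hg using Submodule.span_induction with
      | mem g hg =>
        obtain ⟨g, rfl, rfl⟩ := hg
        refine induction (P := fun x => compMap h₂ ⟨i, by omega⟩ (mk f) (compMap h₁ j (mk g) x) =
          koszulSign k (f.deg * g.deg) • compMap h₄ ⟨j + a - 1, by omega⟩ (mk g)
            (compMap h₃ i (mk f) x)) x (by simp) ?_ ?_ fun x => ?_
        · intro a b ha hb; simp only [map_add, ha, hb, smul_add]
        · intro c a ha; simp only [map_smul, ha]; exact smul_comm _ _ _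
        simp only [compMap_mk]
        exact mk_eq_of_rel _ _ _ (Word.Rel.comp_par h₁ h₂ h₃ h₄ i j hij f g x)
      | zero => simp
      | add y z _ _ hy hz => simp only [map_add, LinearMap.add_apply, hy, hz, smul_add]
      | smul c y _ hy =>
        simp only [map_smul, LinearMap.smul_apply, hy]; exact smul_comm _ _ _
    | zero => simp
    | add y z _ _ hy hz => simp only [map_add, LinearMap.add_apply, hy, hz, smul_add]
    | smul c y _ hy =>
      simp only [map_smul, LinearMap.smul_apply, hy]; exact smul_comm _ _ _
  comp_act := by
    intro m n p h j σ τ f g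
    refine induction (P := fun f => compMap h (τ j) (actMap σ f) (actMap τ g) =
      actMap (insertPerm h σ τ j) (compMap h j f g)) f (by simp) ?_ ?_ fun f => ?_
    · intro a b ha hb; simp only [map_add, LinearMap.add_apply, ha, hb]
    · intro c a ha; simp only [map_smul, LinearMap.smul_apply, ha]
    refine induction (P := fun g => compMap h (τ j) (actMap σ (mk f)) (actMap τ g) =
      actMap (insertPerm h σ τ j) (compMap h j (mk f) g)) g (by simp) ?_ ?_ fun g => ?_
    · intro a b ha hb; simp only [map_add, ha, hb]
    · intro c a ha; simp only [map_smul, ha]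
    simp only [compMap_mk, actMap_mk]
    exact mk_eq_of_rel_one _ _ (Word.Rel.comp_act h j σ τ f g)

namespace FreeOperad

variable {k : Type u} [Field k] (E : Collection.{u, v} k)

variable {E}

/-- The element of the free operad given by a word. -/
noncomputable def word {n : ℕ} (t : Word E n) : (freeOperad E).V n := mk t

theorem act_word {n : ℕ} (σ : Perm (Fin n)) (t : Word E n) :
    (freeOperad E).act n σ (word t) = word (.act σ t) := actMap_mk σ t

theorem comp_word {m n p : ℕ} (h : p + 1 = m + n) (i : Fin n) (s : Word E m) (t : Word E n) :
    (freeOperad E).comp h i (word s) (word t) = word (.comp h i s t) := compMap_mk h i s t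

theorem deg_eq_span (n : ℕ) (j : ℤ) : (freeOperad E).deg n j =
    Submodule.span k {x | ∃ t : Word E n, t.deg = j ∧ word t = x} := rfl

/-- Induction on elements of the free operad. -/
theorem word_induction {n : ℕ} {P : (freeOperad E).V n → Prop} (x : (freeOperad E).V n) (h0 : P 0)
    (hadd : ∀ x y, P x → P y → P (x + y)) (hsmul : ∀ (c : k) x, P x → P (c • x))
    (hw : ∀ t, P (word t)) : P x :=
  induction (P := P) x h0 hadd hsmul hw

variable (E)

/-- The homogeneous elements of degree `j` of the collection, as elements of the free operad. -/
noncomputable def genLin (n : ℕ) (j : ℤ) : E.deg n j →ₗ[k] (freeOperad E).V n where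
  toFun z := word (Word.gen j z)
  map_add' z z' := by
    refine (Submodule.Quotient.eq (Word.relSubmodule E n)).2 ?_
    change Word.Rel (Word.single _ - (Word.single _ + Word.single _))
    rw [← sub_sub]
    exact Word.Rel.gen_add j z z'
  map_smul' c z := mk_eq_of_rel _ _ _ (Word.Rel.gen_smul j c z)

/-- The canonical map from a collection to the free operad. -/
noncomputable def ι (n : ℕ) : E.V n →ₗ[k] (freeOperad E).V n :=
  DirectSum.toModule k ℤ _ (genLin E n) ∘ₗ
    (LinearEquiv.ofBijective (DirectSum.coeLinearMap (E.deg n)) (E.isInternal n)).symm.toLinearMap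

theorem ι_of_mem {n : ℕ} {j : ℤ} (z : E.deg n j) : ι E n z = word (Word.gen j z) := by
  have : (LinearEquiv.ofBijective (DirectSum.coeLinearMap (E.deg n)) (E.isInternal n)).symm z
      = DirectSum.lof k ℤ (fun i => E.deg n i) j z := by
    rw [LinearEquiv.symm_apply_eq]
    exact (DirectSum.coeLinearMap_lof (E.deg n) j z).symm
  simp only [ι, LinearMap.comp_apply, LinearEquiv.coe_coe, this]
  rw [DirectSum.toModule_lof]
  rfl

/-- Evaluation of words in an operad. -/
noncomputable def eval {T : Operad.{u, w} k} (α : ∀ n, E.V n →ₗ[k] T.V n) :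
    ∀ {n : ℕ}, Word E n → T.V n
  | n, .gen _ z => α n z
  | n, .act σ t => T.act n σ (eval α t)
  | _, .comp h i s t => T.comp h i (eval α s) (eval α t)

theorem eval_mem {T : Operad.{u, w} k} {α : ∀ n, E.V n →ₗ[k] T.V n}
    (hdeg : ∀ n j x, x ∈ E.deg n j → α n x ∈ T.deg n j) {n : ℕ} (t : Word E n) :
    eval E α t ∈ T.deg n t.deg := by
  induction t with
  | gen j z => exact hdeg _ _ _ z.2
  | act σ t ih => exact T.act_mem σ ih
  | comp h i s t hs ht => exact T.comp_mem h i hs ht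

theorem eval_rel {T : Operad.{u, w} k} {α : ∀ n, E.V n →ₗ[k] T.V n}
    (hdeg : ∀ n j x, x ∈ E.deg n j → α n x ∈ T.deg n j)
    (hact : ∀ n σ x, α n (E.act n σ x) = T.act n σ (α n x)) {n : ℕ} {x : Word E n →₀ k}
    (hx : Word.Rel x) : Finsupp.linearCombination k (eval E α) x = 0 := by
  have hA : ∀ {n : ℕ} (σ : Perm (Fin n)) (x : Word E n →₀ k),
      Finsupp.linearCombination k (eval E α) (Word.actLin σ x) =
        T.act n σ (Finsupp.linearCombination k (eval E α) x) := by
    intro n σ x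
    refine Word.linear_induction (P := fun x => Finsupp.linearCombination k (eval E α)
      (Word.actLin σ x) = T.act n σ (Finsupp.linearCombination k (eval E α) x)) x
      (by simp) ?_ ?_ ?_
    · intro a b ha hb; simp only [map_add, ha, hb]
    · intro c a ha; simp only [map_smul, ha]
    · intro t; simp [eval]
  have hC : ∀ {m n p : ℕ} (h : p + 1 = m + n) (i : Fin n) (x : Word E m →₀ k)
      (y : Word E n →₀ k), Finsupp.linearCombination k (eval E α) (Word.compLin h i x y) =
        T.comp h i (Finsupp.linearCombination k (eval E α) x)
          (Finsupp.linearCombination k (eval E α) y) := by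
    intro m n p h i x y
    refine Word.linear_induction (P := fun x => Finsupp.linearCombination k (eval E α)
      (Word.compLin h i x y) = T.comp h i (Finsupp.linearCombination k (eval E α) x)
          (Finsupp.linearCombination k (eval E α) y)) x (by simp) ?_ ?_ ?_
    · intro a b ha hb; simp only [map_add, LinearMap.add_apply, ha, hb]
    · intro c a ha; simp only [map_smul, LinearMap.smul_apply, ha]
    intro s
    refine Word.linear_induction (P := fun y => Finsupp.linearCombination k (eval E α)
      (Word.compLin h i (Word.single s) y) =
        T.comp h i (Finsupp.linearCombination k (eval E α) (Word.single s))
          (Finsupp.linearCombination k (eval E α) y)) y (by simp) ?_ ?_ ?_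
    · intro a b ha hb; simp only [map_add, ha, hb]
    · intro c a ha; simp only [map_smul, ha]
    · intro t; simp [eval]
  have hL : ∀ {n : ℕ} (t : Word E n),
      Finsupp.linearCombination k (eval E α) (Word.single t) = eval E α t := by
    intro n t; simp
  induction hx with
  | zero => exact map_zero _
  | add _ _ h1 h2 => rw [map_add, h1, h2, add_zero]
  | smul c _ h1 => rw [map_smul, h1, smul_zero]
  | act σ _ h1 => rw [hA, h1, map_zero]
  | comp_left h i t _ h1 => rw [hC, h1, map_zero, LinearMap.zero_apply]
  | comp_right h i s _ h1 => rw [hC, h1, map_zero]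
  | gen_add j z z' => simp only [map_sub, hL, eval, Submodule.coe_add, map_add]; abel
  | gen_smul j c z => simp only [map_sub, map_smul, hL, eval, Submodule.coe_smul, sub_self]
  | gen_act j σ z => simp only [map_sub, hL, eval, hact, sub_self]
  | act_one t => simp only [map_sub, hL, eval, map_one, Module.End.one_apply, sub_self]
  | act_mul σ τ t => simp only [map_sub, hL, eval, map_mul, Module.End.mul_apply, sub_self]
  | comp_seq h₁ h₂ h₃ h₄ i j s t x =>
    simp only [map_sub, hL, eval]
    rw [T.comp_seq h₁ h₂ h₃ h₄, sub_self]
  | comp_par h₁ h₂ h₃ h₄ i j hij s t x =>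
    simp only [map_sub, map_smul, hL, eval]
    rw [T.comp_par h₁ h₂ h₃ h₄ i j hij _ (eval_mem E hdeg s) (eval_mem E hdeg t), sub_self]
  | comp_act h j σ τ s t =>
    simp only [map_sub, hL, eval]
    rw [T.comp_act, sub_self]

/-- The universal property of the free operad: homomorphisms from it correspond to maps of
collections. -/
theorem existsUnique_hom {T : Operad.{u, w} k} (α : ∀ n, E.V n →ₗ[k] T.V n)
    (hdeg : ∀ n j x, x ∈ E.deg n j → α n x ∈ T.deg n j)
    (hact : ∀ n σ x, α n (E.act n σ x) = T.act n σ (α n x)) :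
    ∃! φ : Operad.Hom (freeOperad E) T, ∀ n x, φ.map n (ι E n x) = α n x := by
  let φ : ∀ n, (freeOperad E).V n →ₗ[k] T.V n := fun n =>
    (Word.relSubmodule E n).liftQ (Finsupp.linearCombination k (eval E α))
      fun _ hx => eval_rel E hdeg hact hx
  have hφ : ∀ {n : ℕ} (t : Word E n), φ n (word t) = eval E α t := by
    intro n t
    change Finsupp.linearCombination k (eval E α) (Word.single t) = _
    simp
  refine ⟨⟨φ, ?_, ?_, ?_⟩, ?_, ?_⟩
  · intro n j x hx
    rw [deg_eq_span] at hx
    induction hx using Submodule.span_induction with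
    | mem x hx =>
      obtain ⟨t, rfl, rfl⟩ := hx
      rw [hφ]
      exact eval_mem E hdeg t
    | zero => rw [map_zero]; exact Submodule.zero_mem _
    | add x y _ _ hx hy => rw [map_add]; exact Submodule.add_mem _ hx hy
    | smul c x _ hx => rw [map_smul]; exact Submodule.smul_mem _ c hx
  · intro n σ x
    refine word_induction (P := fun x => φ n ((freeOperad E).act n σ x) = T.act n σ (φ n x)) x
      (by simp) ?_ ?_ ?_
    · intro a b ha hb; simp only [map_add, ha, hb]
    · intro c a ha; simp only [map_smul, ha]
    · intro t; rw [act_word, hφ, hφ, eval]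
  · intro m n p h i x y
    refine word_induction (P := fun x => φ p ((freeOperad E).comp h i x y) =
      T.comp h i (φ m x) (φ n y)) x (by simp) ?_ ?_ ?_
    · intro a b ha hb; simp only [map_add, LinearMap.add_apply, ha, hb]
    · intro c a ha; simp only [map_smul, LinearMap.smul_apply, ha]
    intro s
    refine word_induction (P := fun y => φ p ((freeOperad E).comp h i (word s) y) =
      T.comp h i (φ m (word s)) (φ n y)) y (by simp) ?_ ?_ ?_
    · intro a b ha hb; simp only [map_add, ha, hb]
    · intro c a ha; simp only [map_smul, ha]
    · intro t; rw [comp_word, hφ, hφ, hφ, eval]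
  · intro n x
    have hle : (⊤ : Submodule k (E.V n)) ≤ LinearMap.eqLocus (φ n ∘ₗ ι E n) (α n) := by
      rw [← E.iSup_deg n]
      refine iSup_le fun j z hz => ?_
      change φ n (ι E n (⟨z, hz⟩ : E.deg n j)) = _
      rw [ι_of_mem, hφ, eval]
    exact hle (Submodule.mem_top (x := x))
  · rintro ⟨ψ, h1, h2, h3⟩ hψ
    have : ψ = φ := by
      funext n
      refine LinearMap.ext fun x => ?_
      refine word_induction (P := fun x => ψ n x = φ n x) x (by simp) ?_ ?_ fun t => ?_
      · intro a b ha hb; rw [map_add, map_add, ha, hb]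
      · intro c a ha; rw [map_smul, map_smul, ha]
      rw [hφ]
      clear x
      induction t with
      | gen j z => rw [← ι_of_mem E z, eval]; exact hψ _ _
      | act σ t ih => rw [eval, ← ih, ← h2, act_word]
      | comp h i s t hs ht => rw [eval, ← hs, ← ht, ← h3, comp_word]
    subst this
    rfl

end FreeOperad

/-! ### Gradings of the free operad -/

/-- A decomposition `E = E⁰ ⊕ E¹ ⊕ ⋯` of a collection into subcollections. -/
structure Collection.Decomposition {k : Type u} [Field k] (E : Collection.{u, v} k) where
  piece : ℕ → ∀ n, Submodule k (E.V n)
  isInternal : ∀ n, DirectSum.IsInternal fun l => piece l n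
  act_mem : ∀ {l n : ℕ} (σ : Perm (Fin n)) {x : E.V n}, x ∈ piece l n → E.act n σ x ∈ piece l n
  /-- Each piece is a graded subspace for the inner grading. -/
  le_iSup_inf_deg : ∀ l n, piece l n ≤ ⨆ j, piece l n ⊓ E.deg n j

/-- `HasTJ P t l` says that the letters of the word `t` belong to pieces `E^{l₁}, E^{l₂}, …` of the
collection with `l₁ + l₂ + ⋯ = l`. -/
inductive Word.HasTJ {k : Type u} [Field k] {E : Collection.{u, v} k} (P : E.Decomposition) :
    ∀ {n : ℕ}, Word E n → ℕ → Prop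
  | gen {n l : ℕ} {j : ℤ} {z : E.deg n j} (hz : (z : E.V n) ∈ P.piece l n) :
      HasTJ P (Word.gen j z) l
  | act {n l : ℕ} (σ : Perm (Fin n)) {t : Word E n} : HasTJ P t l → HasTJ P (Word.act σ t) l
  | comp {m n p l l' : ℕ} (h : p + 1 = m + n) (i : Fin n) {s : Word E m} {t : Word E n} :
      HasTJ P s l → HasTJ P t l' → HasTJ P (Word.comp h i s t) (l + l')

namespace FreeOperad

variable {k : Type u} [Field k] {E : Collection.{u, v} k}

/-- The component of TJ-degree `l` of the free operad on a decomposed collection. -/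
noncomputable def tjPiece (P : E.Decomposition) (l n : ℕ) : Submodule k ((freeOperad E).V n) :=
  Submodule.span k {x | ∃ t : Word E n, t.HasTJ P l ∧ word t = x}

variable (E) in
/-- The part of the free operad spanned by the words of length at least `l`. -/
noncomputable def lengthGE (l n : ℕ) : Submodule k ((freeOperad E).V n) :=
  Submodule.span k {x | ∃ t : Word E n, l ≤ t.length ∧ word t = x}

end FreeOperad

/-! ### The homology operad -/

theorem koszulSign_mul_self (k : Type u) [Field k] (e : ℤ) :
    koszulSign k e * koszulSign k e = 1 := by
  unfold koszulSign
  rcases Int.even_or_odd e with h | h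
  · simp [Int.negOnePow_even e h]
  · simp [Int.negOnePow_odd e h]

namespace Operad

variable {k : Type u} [Field k] {S : Operad.{u, v} k} (d : Differential S)

namespace Differential

/-- The cycles of arity `n`. -/
def cycles (n : ℕ) : Submodule k (S.V n) := LinearMap.ker (d.map n)

/-- The boundaries of arity `n`, as a subspace of the cycles. -/
def boundaries (n : ℕ) : Submodule k (d.cycles n) :=
  (LinearMap.range (d.map n)).comap (d.cycles n).subtype

theorem mem_cycles {n : ℕ} {x : S.V n} : x ∈ d.cycles n ↔ d.map n x = 0 := Iff.rfl

theorem mem_boundaries {n : ℕ} {x : d.cycles n} :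
    x ∈ d.boundaries n ↔ ∃ y, d.map n y = x := Iff.rfl

theorem map_proj (n : ℕ) (j : ℤ) (x : S.V n) :
    d.map n (S.proj n j x) = S.proj n (j - 1) (d.map n x) := by
  have hle : (⊤ : Submodule k (S.V n)) ≤
      LinearMap.eqLocus (d.map n ∘ₗ S.proj n j) (S.proj n (j - 1) ∘ₗ d.map n) := by
    rw [← S.iSup_deg n]
    refine iSup_le fun i x hx => ?_
    change d.map n (S.proj n j x) = S.proj n (j - 1) (d.map n x)
    rw [S.proj_of_mem j hx, S.proj_of_mem (j - 1) (d.map_mem hx)]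
    by_cases h : i = j
    · rw [if_pos h, if_pos (by omega)]
    · rw [if_neg h, if_neg (by omega), map_zero]
  exact hle (Submodule.mem_top (x := x))

theorem proj_mem_cycles {n : ℕ} (j : ℤ) {x : S.V n} (hx : x ∈ d.cycles n) :
    S.proj n j x ∈ d.cycles n := by
  rw [mem_cycles, map_proj, d.mem_cycles.1 hx, map_zero]

theorem map_comp_cycle {m n p : ℕ} (h : p + 1 = m + n) (i : Fin n) (f : S.V m) {g : S.V n}
    (hg : g ∈ d.cycles n) : d.map p (S.comp h i f g) = S.comp h i (d.map m f) g := by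
  refine S.mem_of_proj_mem (LinearMap.eqLocus (d.map p ∘ₗ (S.comp h i).flip g)
    ((S.comp h i).flip g ∘ₗ d.map m)) f fun j => ?_
  change d.map p (S.comp h i (S.proj m j f) g) = S.comp h i (d.map m (S.proj m j f)) g
  rw [d.leibniz h i g (S.proj_mem m j f), d.mem_cycles.1 hg, map_zero, smul_zero, add_zero]

theorem comp_mem_cycles {m n p : ℕ} (h : p + 1 = m + n) (i : Fin n) {f : S.V m} {g : S.V n}
    (hf : f ∈ d.cycles m) (hg : g ∈ d.cycles n) : S.comp h i f g ∈ d.cycles p := by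
  rw [mem_cycles, d.map_comp_cycle h i f hg, d.mem_cycles.1 hf, map_zero, LinearMap.zero_apply]

theorem comp_map_mem_range {m n p : ℕ} (h : p + 1 = m + n) (i : Fin n) {f : S.V m} (g : S.V n)
    (hf : f ∈ d.cycles m) : S.comp h i f (d.map n g) ∈ LinearMap.range (d.map p) := by
  refine S.mem_of_proj_mem ((LinearMap.range (d.map p)).comap
    ((S.comp h i).flip (d.map n g))) f fun j => ?_
  change S.comp h i (S.proj m j f) (d.map n g) ∈ LinearMap.range (d.map p)
  refine ⟨koszulSign k (-1 * j) • S.comp h i (S.proj m j f) g, ?_⟩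
  rw [map_smul, d.leibniz h i g (S.proj_mem m j f), d.mem_cycles.1 (d.proj_mem_cycles j hf),
    map_zero, LinearMap.zero_apply, zero_add, smul_smul, koszulSign_mul_self, one_smul]

/-- The homology of arity `n`. -/
abbrev HomologyCarrier (n : ℕ) : Type v := d.cycles n ⧸ d.boundaries n

/-- The homology class of a cycle. -/
def cls (n : ℕ) : d.cycles n →ₗ[k] d.HomologyCarrier n := (d.boundaries n).mkQ

theorem cls_surjective (n : ℕ) : Function.Surjective (d.cls n) := Submodule.mkQ_surjective _

theorem cls_eq_zero {n : ℕ} {x : d.cycles n} : d.cls n x = 0 ↔ ∃ y, d.map n y = x :=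
  (Submodule.Quotient.mk_eq_zero _).trans d.mem_boundaries

/-- The action of a permutation on cycles. -/
def actCycles {n : ℕ} (σ : Perm (Fin n)) : d.cycles n →ₗ[k] d.cycles n :=
  (S.act n σ).restrict fun x hx => by
    rw [mem_cycles, d.map_act, d.mem_cycles.1 hx, map_zero]

/-- The action of a permutation on homology. -/
def actHomology {n : ℕ} (σ : Perm (Fin n)) : d.HomologyCarrier n →ₗ[k] d.HomologyCarrier n :=
  (d.boundaries n).mapQ (d.boundaries n) (d.actCycles σ) fun x hx => by
    obtain ⟨y, hy⟩ := d.mem_boundaries.1 hx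
    exact d.mem_boundaries.2 ⟨S.act n σ y, by rw [d.map_act, hy]; rfl⟩

theorem actHomology_cls {n : ℕ} (σ : Perm (Fin n)) (x : d.cycles n) :
    d.actHomology σ (d.cls n x) = d.cls n (d.actCycles σ x) := rfl

/-- The composite of two cycles. -/
def compCycles {m n p : ℕ} (h : p + 1 = m + n) (i : Fin n) :
    d.cycles m →ₗ[k] d.cycles n →ₗ[k] d.cycles p :=
  LinearMap.mk₂ k (fun f g => ⟨S.comp h i f g, d.comp_mem_cycles h i f.2 g.2⟩)
    (fun _ _ _ => Subtype.ext (by simp)) (fun _ _ _ => Subtype.ext (by simp))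
    (fun _ _ _ => Subtype.ext (by simp)) (fun _ _ _ => Subtype.ext (by simp))

/-- The partial compositions of the homology operad. -/
def compHomology {m n p : ℕ} (h : p + 1 = m + n) (i : Fin n) :
    d.HomologyCarrier m →ₗ[k] d.HomologyCarrier n →ₗ[k] d.HomologyCarrier p :=
  (d.boundaries m).liftQ
    (LinearMap.flip ((d.boundaries n).liftQ ((d.compCycles h i).compr₂ (d.cls p)).flip
      (fun g hg => by
        obtain ⟨y, hy⟩ := d.mem_boundaries.1 hg
        refine LinearMap.ext fun f => (d.cls_eq_zero).2 ?_
        obtain ⟨w, hw⟩ := d.comp_map_mem_range h i y f.2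
        exact ⟨w, by rw [hw, hy]; rfl⟩)))
    (fun f hf => by
      obtain ⟨y, hy⟩ := d.mem_boundaries.1 hf
      refine LinearMap.ext fun g => ?_
      obtain ⟨g, rfl⟩ := d.cls_surjective n g
      exact (d.cls_eq_zero).2 ⟨S.comp h i y g, by rw [d.map_comp_cycle h i y g.2, hy]; rfl⟩)

theorem compHomology_cls {m n p : ℕ} (h : p + 1 = m + n) (i : Fin n) (f : d.cycles m)
    (g : d.cycles n) :
    d.compHomology h i (d.cls m f) (d.cls n g) = d.cls p (d.compCycles h i f g) := rfl

/-- The part of the homology represented by the cycles lying in a given subspace. -/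
def homologyPiece {n : ℕ} (A : Submodule k (S.V n)) : Submodule k (d.HomologyCarrier n) :=
  (A.comap (d.cycles n).subtype).map (d.cls n)

theorem mem_homologyPiece {n : ℕ} {A : Submodule k (S.V n)} {x : d.HomologyCarrier n} :
    x ∈ d.homologyPiece A ↔ ∃ z : d.cycles n, (z : S.V n) ∈ A ∧ d.cls n z = x := Iff.rfl

/-- Projection of homology onto a component of the inner grading. -/
noncomputable def projHomology (n : ℕ) (j : ℤ) : d.HomologyCarrier n →ₗ[k] d.HomologyCarrier n :=
  (d.boundaries n).mapQ (d.boundaries n)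
    ((S.proj n j).restrict fun _ hx => d.proj_mem_cycles j hx) fun x hx => by
      obtain ⟨y, hy⟩ := d.mem_boundaries.1 hx
      refine d.mem_boundaries.2 ⟨S.proj n (j + 1) y, ?_⟩
      rw [map_proj, add_sub_cancel_right, hy]
      rfl

theorem projHomology_cls {n : ℕ} {i j : ℤ} {x : d.cycles n} (hx : (x : S.V n) ∈ S.deg n i) :
    d.projHomology n j (d.cls n x) = if i = j then d.cls n x else 0 := by
  have h1 : d.projHomology n j (d.cls n x) =
    d.cls n ⟨S.proj n j x, d.proj_mem_cycles j x.2⟩ := rfl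
  have h2 := S.proj_of_mem j hx
  rw [h1]
  split_ifs with h
  · exact congrArg _ (Subtype.ext (h2.trans (if_pos h)))
  · rw [← map_zero (d.cls n)]
    exact congrArg _ (Subtype.ext (h2.trans (if_neg h)))

theorem homology_isInternal (n : ℕ) :
    DirectSum.IsInternal fun j => d.homologyPiece (S.deg n j) := by
  refine isInternal_of_projections _ ?_ (d.projHomology n) ?_ ?_
  · rw [eq_top_iff]
    intro x _
    obtain ⟨⟨x, hx⟩, rfl⟩ := d.cls_surjective n x
    have : x ∈ ((⨆ j, d.homologyPiece (S.deg n j)).comap (d.cls n)).map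
        (d.cycles n).subtype := by
      refine S.mem_of_proj_mem _ x fun j => ?_
      refine ⟨⟨S.proj n j x, d.proj_mem_cycles j hx⟩, ?_, rfl⟩
      exact Submodule.mem_iSup_of_mem j (d.mem_homologyPiece.2 ⟨_, S.proj_mem n j x, rfl⟩)
    obtain ⟨y, hy, rfl⟩ := this
    exact hy
  · intro j x hx
    obtain ⟨z, hz, rfl⟩ := d.mem_homologyPiece.1 hx
    rw [d.projHomology_cls hz, if_pos rfl]
  · intro i j hij x hx
    obtain ⟨z, hz, rfl⟩ := d.mem_homologyPiece.1 hx
    rw [d.projHomology_cls hz, if_neg hij]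

/-- The homology operad of a differential operad. -/
def homology : Operad.{u, v} k where
  V := d.HomologyCarrier
  act n :=
    { toFun := d.actHomology
      map_one' := by
        refine LinearMap.ext fun x => ?_
        obtain ⟨x, rfl⟩ := d.cls_surjective n x
        rw [actHomology_cls]
        exact congrArg (d.cls n) (Subtype.ext (by simp [actCycles]))
      map_mul' := fun σ τ => by
        refine LinearMap.ext fun x => ?_
        obtain ⟨x, rfl⟩ := d.cls_surjective n x
        rw [Module.End.mul_apply, actHomology_cls, actHomology_cls, actHomology_cls]
        exact congrArg (d.cls n) (Subtype.ext (by simp [actCycles])) }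
  deg n j := d.homologyPiece (S.deg n j)
  isInternal := d.homology_isInternal
  act_mem := by
    intro n σ j x hx
    obtain ⟨z, hz, rfl⟩ := d.mem_homologyPiece.1 hx
    exact d.mem_homologyPiece.2 ⟨d.actCycles σ z, S.act_mem σ hz, rfl⟩
  subsingleton_zero := by
    have := S.subsingleton_zero
    exact (d.cls_surjective 0).subsingleton
  comp := d.compHomology
  comp_mem := by
    intro m n p h i s t f g hf hg
    obtain ⟨f, hf', rfl⟩ := d.mem_homologyPiece.1 hf
    obtain ⟨g, hg', rfl⟩ := d.mem_homologyPiece.1 hg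
    exact d.mem_homologyPiece.2 ⟨d.compCycles h i f g, S.comp_mem h i hf' hg', rfl⟩
  comp_seq := by
    intro a b c q r p h₁ h₂ h₃ h₄ i j f g x
    obtain ⟨f, rfl⟩ := d.cls_surjective _ f
    obtain ⟨g, rfl⟩ := d.cls_surjective _ g
    obtain ⟨x, rfl⟩ := d.cls_surjective _ x
    simp only [compHomology_cls]
    exact congrArg (d.cls p) (Subtype.ext (S.comp_seq h₁ h₂ h₃ h₄ i j f.1 g.1 x.1))
  comp_par := by
    intro a b c q r p h₁ h₂ h₃ h₄ i j hij s t f g x hf hg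
    obtain ⟨f, hf', rfl⟩ := d.mem_homologyPiece.1 hf
    obtain ⟨g, hg', rfl⟩ := d.mem_homologyPiece.1 hg
    obtain ⟨x, rfl⟩ := d.cls_surjective _ x
    simp only [compHomology_cls]
    rw [← map_smul (d.cls p)]
    exact congrArg (d.cls p) (Subtype.ext (S.comp_par h₁ h₂ h₃ h₄ i j hij x.1 hf' hg'))
  comp_act := by
    intro m n p h j σ τ f g
    obtain ⟨f, rfl⟩ := d.cls_surjective _ f
    obtain ⟨g, rfl⟩ := d.cls_surjective _ g
    simp only [MonoidHom.coe_mk, OneHom.coe_mk, actHomology_cls, compHomology_cls]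
    exact congrArg (d.cls p) (Subtype.ext (S.comp_act h j σ τ f.1 g.1))

end Differential

/-- The homomorphism `H(S, d) → T` induced by a homomorphism `(S, d) → (T, 0)` of differential
operads; here the homology of `(T, 0)` is identified with `T`. -/
def Hom.homologyDesc {T : Operad.{u, w} k} (φ : Hom S T) (hφ : φ.Commutes d T.zeroDifferential) :
    Hom d.homology T where
  map n := (d.boundaries n).liftQ (φ.map n ∘ₗ (d.cycles n).subtype) fun x hx => by
    obtain ⟨y, hy⟩ := d.mem_boundaries.1 hx
    change φ.map n x = 0
    rw [← hy, hφ]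
    rfl
  map_mem := by
    intro n j x hx
    obtain ⟨z, hz, rfl⟩ := d.mem_homologyPiece.1 hx
    exact φ.map_mem hz
  map_act := by
    intro n σ x
    obtain ⟨x, rfl⟩ := d.cls_surjective _ x
    exact φ.map_act σ x.1
  map_comp := by
    intro m n p h i f g
    obtain ⟨f, rfl⟩ := d.cls_surjective _ f
    obtain ⟨g, rfl⟩ := d.cls_surjective _ g
    exact φ.map_comp h i f.1 g.1

end Operad

-- The model is built by induction on the arity, all TJ-degrees of one arity at once. Suppose that
-- the generators of arity less than n are known: they define a free operad F with a derivation d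
-- and a homomorphism ρ : F → H (`stage`). In arity n, the map x ↦ (dx, ρx) from F(n) to F(n) ⊕ H(n)
-- plays the role of the differential of the mapping cone of ρ. The cycles of bidegree (0, j) are 0
-- ⊕ H(n)_j; those of bidegree (l + 1, j) are the d-cycles of F(n) of TJ-degree l and inner degree j
-- - 1 that ρ kills. The new generators of arity n and given bidegree form a Σ_n-invariant
-- complement of the boundaries in these cycles. It exists by Maschke's theorem, and this is where
-- characteristic zero enters. A generator c = (c₁, c₂) gets the boundary c₁ and the image c₂ in H.
--
-- One pass through the arities suffices. A collection has nothing in arities below two, so neither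
-- has its free operad, and both factors of a nonzero composite of arity n have arity less than n.
-- Hence arity n of the final free operad is spanned by the generators of arity n and by elements of
-- stage n (`tjDeg_le_map_sup`), and generators of higher arity do not affect it. Let z + w be a
-- bihomogeneous cycle of arity n killed by ρ, with z a generator and w from stage n. The pair c
-- attached to z is minus the image of w under the cone map, so c = 0 because the complement meets
-- the boundaries trivially (`eq_zero_of_mem_newGens`). Thus z = 0, and w is a cycle killed by ρ,
-- that is, a cone cycle of the next TJ-degree. It is therefore a cone boundary plus the pair of a
-- new generator (`coneCycles_le`), and so it is a boundary in the model. This is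
-- `exists_d_eq_of_mem_tjDeg`, which gives injectivity in TJ-degree zero and acyclicity in positive
-- TJ-degrees. The cycles 0 ⊕ H(n) give the surjectivity of ρ in the same way for n ≥ 2; in arity
-- one the free operad vanishes, whence the hypothesis H(1) = 0.
--
-- Minimality comes for free: c₁ lies in arity n of stage n, which has no generators of that arity,
-- so c₁ is decomposable.
--
-- Two tools support the construction. A derivation is defined by its values on generators as a
-- homomorphism to a square zero extension (`dualNumbers`). The stages are compared with the limit
-- by maps of collections that have retractions, so that the free operads of the stages embed in
-- that of the limit.

universe w₁

/-! ### Signs -/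

theorem koszulSign_add (k : Type u) [Field k] (a b : ℤ) :
    koszulSign k (a + b) = koszulSign k a * koszulSign k b := by
  simp [koszulSign, Int.negOnePow_add]

namespace SymSeq

variable {k : Type u} [Field k] (S : SymSeq.{u, v} k)

/-- Linear maps agree if they agree on homogeneous elements. -/
theorem hom_ext_of_deg {n : ℕ} {M : Type w} [AddCommGroup M] [Module k M] {f g : S.V n →ₗ[k] M}
    (h : ∀ j, ∀ x ∈ S.deg n j, f x = g x) : f = g := by
  have hle : (⊤ : Submodule k (S.V n)) ≤ LinearMap.eqLocus f g := by
    rw [← S.iSup_deg n]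
    exact iSup_le fun j x hx => h j x hx
  exact LinearMap.ext fun x => hle (Submodule.mem_top (x := x))

/-- The operator multiplying the elements of degree `j` by `(-1)^(e * j)`. -/
noncomputable def signOp (e : ℤ) (n : ℕ) : S.V n →ₗ[k] S.V n :=
  DirectSum.toModule k ℤ _ (fun j => koszulSign k (e * j) • (S.deg n j).subtype) ∘ₗ
    (LinearEquiv.ofBijective (DirectSum.coeLinearMap (S.deg n)) (S.isInternal n)).symm.toLinearMap

variable {S}

theorem signOp_of_mem (e : ℤ) {n : ℕ} {j : ℤ} {x : S.V n} (hx : x ∈ S.deg n j) :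
    S.signOp e n x = koszulSign k (e * j) • x := by
  have : (LinearEquiv.ofBijective (DirectSum.coeLinearMap (S.deg n)) (S.isInternal n)).symm x
      = DirectSum.lof k ℤ (fun i => S.deg n i) j ⟨x, hx⟩ := by
    rw [LinearEquiv.symm_apply_eq]
    exact (DirectSum.coeLinearMap_lof (S.deg n) j ⟨x, hx⟩).symm
  simp only [signOp, LinearMap.comp_apply, LinearEquiv.coe_coe, this, DirectSum.toModule_lof]
  rfl

theorem signOp_mem (e : ℤ) {n : ℕ} {j : ℤ} {x : S.V n} (hx : x ∈ S.deg n j) :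
    S.signOp e n x ∈ S.deg n j := by
  rw [signOp_of_mem e hx]
  exact Submodule.smul_mem _ _ hx

theorem signOp_act (e : ℤ) {n : ℕ} (σ : Perm (Fin n)) (x : S.V n) :
    S.signOp e n (S.act n σ x) = S.act n σ (S.signOp e n x) := by
  have : S.signOp e n ∘ₗ S.act n σ = S.act n σ ∘ₗ S.signOp e n := by
    refine S.hom_ext_of_deg fun j x hx => ?_
    simp only [LinearMap.comp_apply, signOp_of_mem e (S.act_mem σ hx), signOp_of_mem e hx, map_smul]
  exact LinearMap.congr_fun this x

end SymSeq

/-- Direct sum of two internal decompositions with the same index set. -/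
theorem DirectSum.IsInternal.submodule_prod {k : Type u} [Field k] {ι : Type*} [DecidableEq ι]
    {M : Type v} {N : Type w} [AddCommGroup M] [Module k M] [AddCommGroup N] [Module k N]
    {A : ι → Submodule k M} {B : ι → Submodule k N} (hA : DirectSum.IsInternal A)
    (hB : DirectSum.IsInternal B) : DirectSum.IsInternal fun i => (A i).prod (B i) := by
  apply DirectSum.isInternal_submodule_of_iSupIndep_of_iSup_eq_top
  · intro i
    rw [Submodule.disjoint_def]
    rintro ⟨x, y⟩ ⟨hx, hy⟩ h
    have h1 := Submodule.mem_map_of_mem (f := LinearMap.fst k M N) h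
    have h2 := Submodule.mem_map_of_mem (f := LinearMap.snd k M N) h
    simp only [Submodule.map_iSup] at h1 h2
    have e1 : x = 0 := Submodule.disjoint_def.1 (hA.submodule_iSupIndep i) x hx
      ((iSup₂_mono (fun j _ => by rintro _ ⟨z, hz, rfl⟩; exact hz.1) :
        _ ≤ ⨆ (j : ι) (_ : j ≠ i), A j) h1)
    have e2 : y = 0 := Submodule.disjoint_def.1 (hB.submodule_iSupIndep i) y hy
      ((iSup₂_mono (fun j _ => by rintro _ ⟨z, hz, rfl⟩; exact hz.2) :
        _ ≤ ⨆ (j : ι) (_ : j ≠ i), B j) h2)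
    rw [e1, e2]; rfl
  · rw [eq_top_iff]
    rintro ⟨x, y⟩ -
    have h1 : x ∈ (⨆ i, (A i).prod (B i)).comap (LinearMap.inl k M N) := by
      have : x ∈ ⨆ i, A i := hA.submodule_iSup_eq_top ▸ Submodule.mem_top
      refine (iSup_le fun i z hz => ?_ : (⨆ i, A i) ≤ _) this
      exact Submodule.mem_iSup_of_mem i ⟨hz, Submodule.zero_mem _⟩
    have h2 : y ∈ (⨆ i, (A i).prod (B i)).comap (LinearMap.inr k M N) := by
      have : y ∈ ⨆ i, B i := hB.submodule_iSup_eq_top ▸ Submodule.mem_top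
      refine (iSup_le fun i z hz => ?_ : (⨆ i, B i) ≤ _) this
      exact Submodule.mem_iSup_of_mem i ⟨Submodule.zero_mem _, hz⟩
    have := Submodule.add_mem _ (Submodule.mem_comap.1 h1) (Submodule.mem_comap.1 h2)
    simpa using this

/-- Applied to a translation of the index set, this gives the shifted grading on the second summand
of `dualNumbers`. -/
theorem DirectSum.IsInternal.reindex {k : Type u} [Field k] {ι κ : Type*} [DecidableEq ι]
    [DecidableEq κ] {M : Type v} [AddCommGroup M] [Module k M] {A : ι → Submodule k M}
    (hA : DirectSum.IsInternal A) (f : κ ≃ ι) : DirectSum.IsInternal fun i => A (f i) := by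
  apply DirectSum.isInternal_submodule_of_iSupIndep_of_iSup_eq_top
  · exact hA.submodule_iSupIndep.comp f.injective
  · rw [← hA.submodule_iSup_eq_top]
    exact f.iSup_comp (g := A)

/-! ### Square zero extensions of operads -/

namespace Operad

variable {k : Type u} [Field k] (S : Operad.{u, v} k)

/-- The exponent `e * j` is additive in `j`, so the sign is multiplicative under composition.
Associativity in `dualNumbers` along a chain of three operations depends on this. -/
theorem signOp_comp (e : ℤ) {m n p : ℕ} (h : p + 1 = m + n) (i : Fin n) (f : S.V m) (g : S.V n) :
    S.signOp e p (S.comp h i f g) = S.comp h i (S.signOp e m f) (S.signOp e n g) := by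
  have : (S.comp h i).compr₂ (S.signOp e p) =
      (S.comp h i).compl₁₂ (S.signOp e m) (S.signOp e n) := by
    refine S.hom_ext_of_deg fun s f hf => S.hom_ext_of_deg fun t g hg => ?_
    simp only [LinearMap.compr₂_apply, LinearMap.compl₁₂_apply]
    rw [SymSeq.signOp_of_mem e hf, SymSeq.signOp_of_mem e hg,
      SymSeq.signOp_of_mem e (S.comp_mem h i hf hg), mul_add, koszulSign_add]
    simp only [map_smul, LinearMap.smul_apply, smul_smul, mul_comm]
  exact LinearMap.congr_fun (LinearMap.congr_fun this f) g

/-- The square zero extension `S ⊕ εS` of an operad, `ε` being of degree `-e`: homomorphisms to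
it over `S` are derivations of degree `e`. -/
noncomputable def dualNumbers (e : ℤ) : Operad.{u, v} k where
  V n := S.V n × S.V n
  act n :=
    { toFun := fun σ => (S.act n σ).prodMap (S.act n σ)
      map_one' := by ext <;> simp
      map_mul' := fun σ τ => by ext <;> simp }
  deg n j := (S.deg n j).prod (S.deg n (j + e))
  isInternal n := (S.isInternal n).submodule_prod ((S.isInternal n).reindex (Equiv.addRight e))
  act_mem σ _ _ hx := ⟨S.act_mem σ hx.1, S.act_mem σ hx.2⟩
  subsingleton_zero := by
    have := S.subsingleton_zero
    infer_instance
  comp {m n p} h i := LinearMap.mk₂ k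
    -- The second component is the Leibniz rule: an operator of degree `e` acts on `f`, or passes
    -- `f` with the Koszul sign and acts on `g`.
    (fun f g => (S.comp h i f.1 g.1, S.comp h i f.2 g.1 + S.comp h i (S.signOp e m f.1) g.2))
    (fun _ _ _ => Prod.ext (by simp) (by simp; abel))
    (fun _ _ _ => Prod.ext (by simp) (by simp))
    (fun _ _ _ => Prod.ext (by simp) (by simp; abel))
    (fun _ _ _ => Prod.ext (by simp) (by simp))
  comp_mem := by
    intro m n p h i s t f g hf hg
    refine ⟨S.comp_mem h i hf.1 hg.1, Submodule.add_mem _ ?_ ?_⟩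
    · have := S.comp_mem h i hf.2 hg.1
      rwa [add_right_comm] at this
    · have := S.comp_mem h i (SymSeq.signOp_mem e hf.1) hg.2
      rwa [← add_assoc] at this
  comp_seq := by
    intro a b c q r p h₁ h₂ h₃ h₄ i j f g x
    refine Prod.ext (S.comp_seq h₁ h₂ h₃ h₄ i j f.1 g.1 x.1) ?_
    simp only [LinearMap.mk₂_apply, map_add, LinearMap.add_apply, signOp_comp]
    rw [S.comp_seq h₁ h₂ h₃ h₄, S.comp_seq h₁ h₂ h₃ h₄, S.comp_seq h₁ h₂ h₃ h₄, add_assoc]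
  comp_par := by
    intro a b c q r p h₁ h₂ h₃ h₄ i j hij s t f g x hf hg
    refine Prod.ext (S.comp_par h₁ h₂ h₃ h₄ i j hij x.1 hf.1 hg.1) ?_
    simp only [LinearMap.mk₂_apply, map_add, Prod.smul_snd]
    rw [S.comp_par h₁ h₂ h₃ h₄ i j hij x.1 hf.2 hg.1,
      S.comp_par h₁ h₂ h₃ h₄ i j hij x.1 (SymSeq.signOp_mem e hf.1) hg.2,
      S.comp_par h₁ h₂ h₃ h₄ i j hij x.2 (SymSeq.signOp_mem e hf.1) (SymSeq.signOp_mem e hg.1),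
      SymSeq.signOp_of_mem e hf.1, SymSeq.signOp_of_mem e hg.1]
    simp only [map_smul, LinearMap.smul_apply, smul_add, smul_smul, add_mul, mul_add,
      koszulSign_add]
    -- The summands in `f.2` and `g.2` trade places. Exchanging `f.1` with `g.2`, of degree `t + e`,
    -- costs an extra `koszulSign k (s * e)`, which cancels the sign of `signOp e` on `f.1`.
    rw [add_left_comm, mul_comm s e, mul_assoc (koszulSign k (s * t)) (koszulSign k (e * s)),
      koszulSign_mul_self, mul_one]
  comp_act := by
    intro m n p h j σ τ f g
    refine Prod.ext (S.comp_act h j σ τ f.1 g.1) ?_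
    simp only [LinearMap.mk₂_apply, MonoidHom.coe_mk, OneHom.coe_mk, LinearMap.prodMap_apply,
      map_add, SymSeq.signOp_act, S.comp_act]

end Operad

/-! ### Homomorphisms and derivations of a free operad, determined on generators -/

namespace FreeOperad

variable {k : Type u} [Field k] {E : Collection.{u, v} k}

theorem word_mem {n : ℕ} (t : Word E n) : word t ∈ (freeOperad E).deg n t.deg :=
  mk_mem t

/-- A family of subspaces containing the generators and closed under the operations is
everything. -/
theorem closure_induction (K : ∀ n : ℕ, Submodule k ((freeOperad E).V n))
    (hι : ∀ n j, ∀ z ∈ E.deg n j, ι E n z ∈ K n)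
    (hact : ∀ {n : ℕ} (σ : Perm (Fin n)) (x), x ∈ K n → (freeOperad E).act n σ x ∈ K n)
    (hcomp : ∀ {m n p : ℕ} (h : p + 1 = m + n) (i : Fin n) (s : ℤ) (f) (g),
      f ∈ (freeOperad E).deg m s → f ∈ K m → g ∈ K n → (freeOperad E).comp h i f g ∈ K p)
    {n : ℕ} (x : (freeOperad E).V n) : x ∈ K n := by
  refine word_induction (P := fun x => x ∈ K n) x (Submodule.zero_mem _)
    (fun _ _ => Submodule.add_mem _) (fun c _ => Submodule.smul_mem _ c) fun t => ?_
  induction t with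
  | gen j z => rw [← ι_of_mem]; exact hι _ j _ z.2
  | act σ t ih => rw [← act_word]; exact hact σ _ (ih (word t))
  | comp h i s t hs ht =>
    rw [← comp_word]; exact hcomp h i _ _ _ (word_mem s) (hs (word s)) (ht (word t))

theorem ι_mem {n : ℕ} {j : ℤ} {z : E.V n} (hz : z ∈ E.deg n j) :
    ι E n z ∈ (freeOperad E).deg n j := by
  have := word_mem (Word.gen j (⟨z, hz⟩ : E.deg n j))
  rwa [Word.deg, ← ι_of_mem] at this

theorem act_ι {n : ℕ} (σ : Perm (Fin n)) (z : E.V n) :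
    (freeOperad E).act n σ (ι E n z) = ι E n (E.act n σ z) := by
  have : (freeOperad E).act n σ ∘ₗ ι E n = ι E n ∘ₗ E.act n σ := by
    refine E.hom_ext_of_deg fun j z hz => ?_
    simp only [LinearMap.comp_apply]
    rw [ι_of_mem E (⟨z, hz⟩ : E.deg n j), ι_of_mem E (⟨_, E.act_mem σ hz⟩ : E.deg n j), act_word]
    exact mk_eq_of_rel_one _ _ (Word.Rel.gen_act j σ ⟨z, hz⟩)
  exact LinearMap.congr_fun this z

/-- The homomorphism from the free operad extending a map of collections. -/
noncomputable def lift {T : Operad.{u, w} k} (α : ∀ n, E.V n →ₗ[k] T.V n)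
    (hdeg : ∀ n j x, x ∈ E.deg n j → α n x ∈ T.deg n j)
    (hact : ∀ n σ x, α n (E.act n σ x) = T.act n σ (α n x)) : Operad.Hom (freeOperad E) T :=
  (existsUnique_hom E α hdeg hact).choose

@[simp] theorem lift_ι {T : Operad.{u, w} k} (α : ∀ n, E.V n →ₗ[k] T.V n)
    (hdeg : ∀ n j x, x ∈ E.deg n j → α n x ∈ T.deg n j)
    (hact : ∀ n σ x, α n (E.act n σ x) = T.act n σ (α n x)) (n : ℕ) (z : E.V n) :
    (lift α hdeg hact).map n (ι E n z) = α n z :=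
  (existsUnique_hom E α hdeg hact).choose_spec.1 n z

/-- The homomorphism to the square zero extension defined by a map on generators. -/
noncomputable def dualLift {e : ℤ} (δ : ∀ n, E.V n →ₗ[k] (freeOperad E).V n)
    (hdeg : ∀ n j x, x ∈ E.deg n j → δ n x ∈ (freeOperad E).deg n (j + e))
    (hact : ∀ n σ x, δ n (E.act n σ x) = (freeOperad E).act n σ (δ n x)) :
    Operad.Hom (freeOperad E) ((freeOperad E).dualNumbers e) :=
  lift (T := (freeOperad E).dualNumbers e) (fun n => (ι E n).prod (δ n))
    (fun n j x hx => ⟨ι_mem hx, hdeg n j x hx⟩)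
    (fun n σ x => Prod.ext (act_ι σ x).symm (hact n σ x))

/-- The first component is a homomorphism that fixes the generators. Being the identity, it makes
the second component a derivation of the free operad itself, as the Leibniz rule requires. -/
theorem dualLift_fst {e : ℤ} (δ : ∀ n, E.V n →ₗ[k] (freeOperad E).V n)
    (hdeg : ∀ n j x, x ∈ E.deg n j → δ n x ∈ (freeOperad E).deg n (j + e))
    (hact : ∀ n σ x, δ n (E.act n σ x) = (freeOperad E).act n σ (δ n x)) {n : ℕ}
    (x : (freeOperad E).V n) : ((dualLift δ hdeg hact).map n x).1 = x := by
  refine closure_induction (fun n => LinearMap.eqLocus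
    (LinearMap.fst k _ _ ∘ₗ (dualLift δ hdeg hact).map n) LinearMap.id) ?_ ?_ ?_ x
  · intro n j z _
    exact congrArg Prod.fst (lift_ι (T := (freeOperad E).dualNumbers e) _ _ _ n z)
  · intro n σ x hx
    change ((dualLift δ hdeg hact).map n _).1 = _
    rw [(dualLift δ hdeg hact).map_act]
    exact congrArg ((freeOperad E).act n σ) hx
  · intro m n p h i s f g _ hf hg
    change ((dualLift δ hdeg hact).map p _).1 = _
    rw [(dualLift δ hdeg hact).map_comp]
    exact congrArg₂ (fun x y => (freeOperad E).comp h i x y) hf hg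

/-- The derivation of the free operad extending an equivariant map on generators. -/
noncomputable def derivation {e : ℤ} (δ : ∀ n, E.V n →ₗ[k] (freeOperad E).V n)
    (hdeg : ∀ n j x, x ∈ E.deg n j → δ n x ∈ (freeOperad E).deg n (j + e))
    (hact : ∀ n σ x, δ n (E.act n σ x) = (freeOperad E).act n σ (δ n x)) :
    Operad.Derivation (freeOperad E) e where
  map n := LinearMap.snd k _ _ ∘ₗ (dualLift δ hdeg hact).map n
  map_mem hx := ((dualLift δ hdeg hact).map_mem hx).2
  map_act σ x := congrArg Prod.snd ((dualLift δ hdeg hact).map_act σ x)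
  leibniz := by
    intro m n p h i s f g hf
    have := congrArg Prod.snd ((dualLift δ hdeg hact).map_comp h i f g)
    refine this.trans ?_
    change (freeOperad E).comp h i _ ((dualLift δ hdeg hact).map n g).1 +
      (freeOperad E).comp h i ((freeOperad E).signOp e m ((dualLift δ hdeg hact).map m f).1) _ = _
    rw [dualLift_fst, dualLift_fst, SymSeq.signOp_of_mem e hf, map_smul, LinearMap.smul_apply]
    rfl

@[simp] theorem derivation_ι {e : ℤ} (δ : ∀ n, E.V n →ₗ[k] (freeOperad E).V n)
    (hdeg : ∀ n j x, x ∈ E.deg n j → δ n x ∈ (freeOperad E).deg n (j + e))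
    (hact : ∀ n σ x, δ n (E.act n σ x) = (freeOperad E).act n σ (δ n x)) (n : ℕ) (z : E.V n) :
    (derivation δ hdeg hact).map n (ι E n z) = δ n z :=
  congrArg Prod.snd (lift_ι (T := (freeOperad E).dualNumbers e) _ _ _ n z)

/-- A derivation of degree `-1` squares to zero if it does so on generators. -/
theorem derivation_sq_eq_zero (D : Operad.Derivation (freeOperad E) (-1))
    (hD : ∀ n z, D.map n (D.map n (ι E n z)) = 0) (n : ℕ) (x : (freeOperad E).V n) :
    D.map n (D.map n x) = 0 := by
  refine closure_induction (fun n => LinearMap.ker (D.map n ∘ₗ D.map n)) ?_ ?_ ?_ x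
  · exact fun n j z _ => hD n z
  · intro n σ x hx
    change D.map n (D.map n _) = 0
    have hx : D.map n (D.map n x) = 0 := hx
    rw [D.map_act, D.map_act, hx, map_zero]
  · intro m n p h i s f g hs hf hg
    change D.map p (D.map p _) = 0
    have hf : D.map m (D.map m f) = 0 := hf
    have hg : D.map n (D.map n g) = 0 := hg
    rw [D.leibniz h i g hs, map_add, map_smul, D.leibniz h i g (D.map_mem hs),
      D.leibniz h i _ hs, hf, hg, mul_add, koszulSign_add]
    -- The two terms in `D f` and `D g` cancel: `D f` has degree `s - 1`, so their signs are
    -- opposite.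
    simp [koszulSign]

/-- Compatibility of a homomorphism of free operads with derivations is checked on generators. -/
theorem hom_comm_derivation {E' : Collection.{u, w} k} {e : ℤ}
    (φ : Operad.Hom (freeOperad E) (freeOperad E'))
    (D : Operad.Derivation (freeOperad E) e) (D' : Operad.Derivation (freeOperad E') e)
    (h : ∀ n z, φ.map n (D.map n (ι E n z)) = D'.map n (φ.map n (ι E n z)))
    {n : ℕ} (x : (freeOperad E).V n) : φ.map n (D.map n x) = D'.map n (φ.map n x) := by
  refine closure_induction (fun n => LinearMap.eqLocus (φ.map n ∘ₗ D.map n)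
    (D'.map n ∘ₗ φ.map n)) ?_ ?_ ?_ x
  · exact fun n j z _ => h n z
  · intro n σ x hx
    change φ.map n (D.map n _) = D'.map n (φ.map n _)
    rw [D.map_act, φ.map_act, φ.map_act, D'.map_act]
    exact congrArg _ hx
  · intro m n p h i s f g hs hf hg
    change φ.map p (D.map p _) = D'.map p (φ.map p _)
    have hf : φ.map m (D.map m f) = D'.map m (φ.map m f) := hf
    have hg : φ.map n (D.map n g) = D'.map n (φ.map n g) := hg
    rw [D.leibniz h i g hs, map_add, map_smul, φ.map_comp, φ.map_comp, φ.map_comp,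
      D'.leibniz h i _ (φ.map_mem hs), hf, hg]

/-- A homomorphism kills the image of a derivation if it kills that of the generators. -/
theorem hom_derivation_eq_zero {T : Operad.{u, w} k} {e : ℤ} (φ : Operad.Hom (freeOperad E) T)
    (D : Operad.Derivation (freeOperad E) e) (h : ∀ n z, φ.map n (D.map n (ι E n z)) = 0)
    {n : ℕ} (x : (freeOperad E).V n) : φ.map n (D.map n x) = 0 := by
  refine closure_induction (fun n => LinearMap.ker (φ.map n ∘ₗ D.map n)) ?_ ?_ ?_ x
  · exact fun n j z _ => h n z
  · intro n σ x hx
    change φ.map n (D.map n _) = 0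
    have hx : φ.map n (D.map n x) = 0 := hx
    rw [D.map_act, φ.map_act, hx, map_zero]
  · intro m n p h i s f g hs hf hg
    change φ.map p (D.map p _) = 0
    have hf : φ.map m (D.map m f) = 0 := hf
    have hg : φ.map n (D.map n g) = 0 := hg
    rw [D.leibniz h i g hs, map_add, map_smul, φ.map_comp, φ.map_comp, hf, hg]
    simp

/-- Two homomorphisms agree if they agree on generators. -/
theorem hom_ext_ι {T : Operad.{u, w} k} {φ ψ : Operad.Hom (freeOperad E) T}
    (h : ∀ n z, φ.map n (ι E n z) = ψ.map n (ι E n z)) {n : ℕ} (x : (freeOperad E).V n) :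
    φ.map n x = ψ.map n x := by
  refine closure_induction (fun n => LinearMap.eqLocus (φ.map n) (ψ.map n)) ?_ ?_ ?_ x
  · exact fun n j z _ => h n z
  · intro n σ x hx
    change φ.map n _ = ψ.map n _
    rw [φ.map_act, ψ.map_act]
    exact congrArg _ hx
  · intro m n p h i s f g _ hf hg
    change φ.map p _ = ψ.map p _
    have hf : φ.map m f = ψ.map m f := hf
    have hg : φ.map n g = ψ.map n g := hg
    rw [φ.map_comp, ψ.map_comp, hf, hg]

/-- The free operad vanishes in arities below two. -/
theorem eq_zero_of_lt_two {n : ℕ} (hn : n < 2) (x : (freeOperad E).V n) : x = 0 := by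
  -- An infimum over proofs of `n < 2` is `⊥` in those arities and `⊤` in the others. This turns a
  -- conditional claim into a family of subspaces; the same device is used below with conditions on
  -- the TJ-degree.
  have := closure_induction (E := E) (fun n => ⨅ _ : n < 2, (⊥ : Submodule k _)) ?_ ?_ ?_ x
  · simpa [hn] using this
  · intro n j z _
    simp only [Submodule.mem_iInf, Submodule.mem_bot]
    intro hn
    have := E.subsingleton_of_lt_two n hn
    rw [Subsingleton.elim z 0, map_zero]
  · intro n σ x hx
    simp only [Submodule.mem_iInf, Submodule.mem_bot] at hx ⊢
    intro hn
    rw [hx hn, map_zero]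
  · intro m n p h i s f g _ hf _
    simp only [Submodule.mem_iInf, Submodule.mem_bot] at hf ⊢
    intro hp
    have := i.2
    -- Since `n ≥ 1` and `p ≤ 1`, the inserted operation has arity at most one.
    rw [hf (by omega), map_zero, LinearMap.zero_apply]

end FreeOperad

/-! ### Maps of collections -/

/-- A map of collections: equivariant linear maps of degree zero. -/
structure Collection.Map {k : Type u} [Field k] (E : Collection.{u, v} k)
    (E' : Collection.{u, w} k) where
  map : ∀ n, E.V n →ₗ[k] E'.V n
  map_mem : ∀ {n : ℕ} {j : ℤ} {x : E.V n}, x ∈ E.deg n j → map n x ∈ E'.deg n j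
  map_act : ∀ {n : ℕ} (σ : Perm (Fin n)) (x : E.V n), map n (E.act n σ x) = E'.act n σ (map n x)

namespace Operad.Hom

variable {k : Type u} [Field k]

/-- The composite of two homomorphisms of operads. -/
def comp {S : Operad.{u, v} k} {T : Operad.{u, w} k} {U : Operad.{u, w₁} k} (ψ : Hom T U)
    (φ : Hom S T) : Hom S U where
  map n := ψ.map n ∘ₗ φ.map n
  map_mem hx := ψ.map_mem (φ.map_mem hx)
  map_act σ x := by simp [φ.map_act, ψ.map_act]
  map_comp h i f g := by simp [φ.map_comp, ψ.map_comp]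

/-- The identity homomorphism. -/
def id (S : Operad.{u, v} k) : Hom S S where
  map _ := LinearMap.id
  map_mem hx := hx
  map_act _ _ := rfl
  map_comp _ _ _ _ := rfl

end Operad.Hom

/-! ### Functoriality of the free operad -/

namespace FreeOperad

variable {k : Type u} [Field k] {E : Collection.{u, v} k} {E' : Collection.{u, v} k}

/-- The homomorphism of free operads induced by a map of collections. -/
noncomputable def mapHom (φ : E.Map E') : Operad.Hom (freeOperad E) (freeOperad E') :=
  lift (fun n => ι E' n ∘ₗ φ.map n) (fun _ _ _ hx => ι_mem (φ.map_mem hx))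
    (fun n σ x => by simp [φ.map_act, act_ι])

@[simp] theorem mapHom_ι (φ : E.Map E') (n : ℕ) (z : E.V n) :
    (mapHom φ).map n (ι E n z) = ι E' n (φ.map n z) :=
  lift_ι _ _ _ n z

theorem mapHom_mapHom {E'' : Collection.{u, v} k} (φ : E.Map E') (φ' : E'.Map E'')
    (φ'' : E.Map E'') (h : ∀ n z, φ'.map n (φ.map n z) = φ''.map n z) {n : ℕ}
    (x : (freeOperad E).V n) :
    (mapHom φ').map n ((mapHom φ).map n x) = (mapHom φ'').map n x :=
  hom_ext_ι (φ := (mapHom φ').comp (mapHom φ)) (ψ := mapHom φ'')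
    (fun n z => by simp [Operad.Hom.comp, h]) x

/-- A retraction of collections induces a retraction of free operads. No normal form for words
modulo the relations is needed. -/
theorem mapHom_injective (φ : E.Map E') (ψ : E'.Map E) (h : ∀ n z, ψ.map n (φ.map n z) = z)
    (n : ℕ) : Function.Injective ((mapHom φ).map n) := by
  have : ∀ x, (mapHom ψ).map n ((mapHom φ).map n x) = x := fun x =>
    hom_ext_ι (φ := (mapHom ψ).comp (mapHom φ)) (ψ := Operad.Hom.id _)
      (fun n z => by simp [Operad.Hom.comp, Operad.Hom.id, h]) x
  exact Function.LeftInverse.injective this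

/-! ### The bigrading of the free operad -/

/-- The component of TJ-degree `l` and inner degree `j`. -/
noncomputable def tjDeg (P : E.Decomposition) (l : ℕ) (j : ℤ) (n : ℕ) :
    Submodule k ((freeOperad E).V n) :=
  Submodule.span k {x | ∃ t : Word E n, t.HasTJ P l ∧ t.deg = j ∧ word t = x}

variable {P : E.Decomposition} {P' : E'.Decomposition}

theorem ι_mem_tjDeg {l : ℕ} {j : ℤ} {n : ℕ} {z : E.V n} (hl : z ∈ P.piece l n)
    (hj : z ∈ E.deg n j) : ι E n z ∈ tjDeg P l j n := by
  refine Submodule.subset_span ⟨Word.gen j ⟨z, hj⟩, Word.HasTJ.gen hl, by rw [Word.deg], ?_⟩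
  exact (ι_of_mem E (⟨z, hj⟩ : E.deg n j)).symm

theorem act_mem_tjDeg {l : ℕ} {j : ℤ} {n : ℕ} (σ : Perm (Fin n)) {x : (freeOperad E).V n}
    (hx : x ∈ tjDeg P l j n) : (freeOperad E).act n σ x ∈ tjDeg P l j n := by
  have : tjDeg P l j n ≤ (tjDeg P l j n).comap ((freeOperad E).act n σ) := by
    refine Submodule.span_le.2 ?_
    rintro _ ⟨t, ht, hd, rfl⟩
    exact Submodule.subset_span ⟨Word.act σ t, ht.act σ, hd, (act_word σ t).symm⟩
  exact this hx

theorem comp_mem_tjDeg {l l' : ℕ} {j j' : ℤ} {m n p : ℕ} (h : p + 1 = m + n) (i : Fin n)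
    {f : (freeOperad E).V m} {g : (freeOperad E).V n} (hf : f ∈ tjDeg P l j m)
    (hg : g ∈ tjDeg P l' j' n) : (freeOperad E).comp h i f g ∈ tjDeg P (l + l') (j + j') p := by
  have := Submodule.apply_mem_map₂ ((freeOperad E).comp h i) hf hg
  rw [tjDeg, tjDeg, Submodule.map₂_span_span] at this
  refine Submodule.span_mono ?_ this
  rintro _ ⟨_, ⟨s, hs, rfl, rfl⟩, _, ⟨t, ht, rfl, rfl⟩, rfl⟩
  exact ⟨Word.comp h i s t, hs.comp h i ht, by rw [Word.deg], (comp_word h i s t).symm⟩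

/-- The bigraded components are the smallest family of subspaces containing the generators and
closed under the operations. -/
theorem tjDeg_le (K : ∀ n : ℕ, ℕ → ℤ → Submodule k ((freeOperad E).V n))
    (hι : ∀ {n l j z}, z ∈ P.piece l n → z ∈ E.deg n j → ι E n z ∈ K n l j)
    (hact : ∀ {n l j} (σ : Perm (Fin n)) {x}, x ∈ K n l j → (freeOperad E).act n σ x ∈ K n l j)
    (hcomp : ∀ {m n p : ℕ} (h : p + 1 = m + n) (i : Fin n) {l l' j j' f g},
      f ∈ tjDeg P l j m → g ∈ tjDeg P l' j' n → f ∈ K m l j → g ∈ K n l' j' →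
      (freeOperad E).comp h i f g ∈ K p (l + l') (j + j')) (l : ℕ) (j : ℤ) (n : ℕ) :
    tjDeg P l j n ≤ K n l j := by
  refine Submodule.span_le.2 ?_
  rintro _ ⟨t, ht, rfl, rfl⟩
  induction ht with
  | @gen n l j z hz =>
    rw [← ι_of_mem, Word.deg]
    exact hι hz z.2
  | act σ _ ih =>
    rw [← act_word, Word.deg]
    exact hact σ ih
  | comp h i hs ht ihs iht =>
    rw [← comp_word, Word.deg]
    exact hcomp h i (Submodule.subset_span ⟨_, hs, rfl, rfl⟩)
      (Submodule.subset_span ⟨_, ht, rfl, rfl⟩) ihs iht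

theorem tjDeg_le_deg (l : ℕ) (j : ℤ) (n : ℕ) : tjDeg P l j n ≤ (freeOperad E).deg n j := by
  refine Submodule.span_le.2 ?_
  rintro _ ⟨t, -, rfl, rfl⟩
  exact word_mem t

theorem tjDeg_le_tjPiece (l : ℕ) (j : ℤ) (n : ℕ) : tjDeg P l j n ≤ tjPiece P l n :=
  Submodule.span_mono fun _ ⟨t, ht, _, h⟩ => ⟨t, ht, h⟩

/-- A word is homogeneous for the inner grading, so the projection keeps it or kills it. This
reduces claims about a TJ-degree to bihomogeneous elements. -/
theorem proj_mem_tjDeg {l : ℕ} (j : ℤ) {n : ℕ} {x : (freeOperad E).V n}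
    (hx : x ∈ tjPiece P l n) : (freeOperad E).proj n j x ∈ tjDeg P l j n := by
  have : tjPiece P l n ≤ (tjDeg P l j n).comap ((freeOperad E).proj n j) := by
    refine Submodule.span_le.2 ?_
    rintro _ ⟨t, ht, rfl⟩
    change (freeOperad E).proj n j (word t) ∈ tjDeg P l j n
    rw [SymSeq.proj_of_mem _ j (word_mem t)]
    split_ifs with h
    · exact Submodule.subset_span ⟨t, ht, h, rfl⟩
    · exact Submodule.zero_mem _
  exact this hx

/-- Each piece of the decomposition is spanned by elements that are also homogeneous for the inner
grading, so the generators are sums of bihomogeneous ones; bidegrees add under composition. -/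
theorem iSup_tjDeg (P : E.Decomposition) (n : ℕ) :
    ⨆ i : ℕ × ℤ, tjDeg P i.1 i.2 n = ⊤ := by
  rw [eq_top_iff]
  intro x _
  refine closure_induction (fun n => ⨆ i : ℕ × ℤ, tjDeg P i.1 i.2 n) ?_ ?_ ?_ x
  · intro n j z _
    have : ⨆ l, P.piece l n ≤ (⨆ i : ℕ × ℤ, tjDeg P i.1 i.2 n).comap (ι E n) := by
      refine iSup_le fun l => (P.le_iSup_inf_deg l n).trans (iSup_le fun j z hz => ?_)
      exact Submodule.mem_iSup_of_mem (l, j) (ι_mem_tjDeg hz.1 hz.2)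
    rw [(P.isInternal n).submodule_iSup_eq_top] at this
    exact this Submodule.mem_top
  · intro n σ x hx
    have : ⨆ i : ℕ × ℤ, tjDeg P i.1 i.2 n ≤
        (⨆ i : ℕ × ℤ, tjDeg P i.1 i.2 n).comap ((freeOperad E).act n σ) :=
      iSup_le fun i x hx => Submodule.mem_iSup_of_mem i (act_mem_tjDeg σ hx)
    exact this hx
  · intro m n p h i _ f g _ hf hg
    have := Submodule.apply_mem_map₂ ((freeOperad E).comp h i) hf hg
    rw [Submodule.map₂_iSup_left] at this
    simp only [Submodule.map₂_iSup_right] at this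
    refine (iSup_le fun a => iSup_le fun b => Submodule.map₂_le.2 fun f hf g hg => ?_ :
      _ ≤ ⨆ i : ℕ × ℤ, tjDeg P i.1 i.2 p) this
    exact Submodule.mem_iSup_of_mem (a.1 + b.1, a.2 + b.2) (comp_mem_tjDeg h i hf hg)

theorem mapHom_mem_tjDeg {φ : E.Map E'}
    (hφ : ∀ {l n z}, z ∈ P.piece l n → φ.map n z ∈ P'.piece l n) {l : ℕ} {j : ℤ} {n : ℕ}
    {x : (freeOperad E).V n} (hx : x ∈ tjDeg P l j n) :
    (mapHom φ).map n x ∈ tjDeg P' l j n := by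
  refine tjDeg_le (P := P) (fun n l j => (tjDeg P' l j n).comap ((mapHom φ).map n))
    ?_ ?_ ?_ l j n hx
  · intro n l j z hl hj
    rw [Submodule.mem_comap, mapHom_ι]
    exact ι_mem_tjDeg (hφ hl) (φ.map_mem hj)
  · intro n l j σ x hx
    rw [Submodule.mem_comap, (mapHom φ).map_act]
    exact act_mem_tjDeg σ hx
  · intro m n p h i l l' j j' f g _ _ hf hg
    rw [Submodule.mem_comap, (mapHom φ).map_comp]
    exact comp_mem_tjDeg h i hf hg

/-- A derivation killing the generators of TJ-degree zero kills the part of TJ-degree zero. -/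
theorem derivation_eq_zero_of_tj_zero {e : ℤ} (D : Operad.Derivation (freeOperad E) e)
    (hD : ∀ {n z}, z ∈ P.piece 0 n → D.map n (ι E n z) = 0) {j : ℤ} {n : ℕ}
    {x : (freeOperad E).V n} (hx : x ∈ tjDeg P 0 j n) : D.map n x = 0 := by
  have := tjDeg_le (P := P) (fun n l _ => ⨅ _ : l = 0, LinearMap.ker (D.map n)) ?_ ?_ ?_ 0 j n hx
  · simpa using this
  · intro n l j z hl _
    simp only [Submodule.mem_iInf, LinearMap.mem_ker]
    rintro rfl
    exact hD hl
  · intro n l j σ x hx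
    simp only [Submodule.mem_iInf, LinearMap.mem_ker] at hx ⊢
    intro hl
    rw [D.map_act, hx hl, map_zero]
  · intro m n p h i l l' j j' f g hf' _ hf hg
    simp only [Submodule.mem_iInf, LinearMap.mem_ker] at hf hg ⊢
    intro hl
    rw [D.leibniz h i g (tjDeg_le_deg l j m hf'), hf (by omega), hg (by omega)]
    simp

/-- A homomorphism killing the generators of positive TJ-degree kills the part of positive
TJ-degree. -/
theorem hom_eq_zero_of_tj_pos {T : Operad.{u, w} k} (ρ : Operad.Hom (freeOperad E) T)
    (hρ : ∀ {l n z}, z ∈ P.piece (l + 1) n → ρ.map n (ι E n z) = 0) {l : ℕ} {j : ℤ} {n : ℕ}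
    {x : (freeOperad E).V n} (hx : x ∈ tjDeg P (l + 1) j n) : ρ.map n x = 0 := by
  have := tjDeg_le (P := P) (fun n l _ => ⨅ _ : l ≠ 0, LinearMap.ker (ρ.map n))
    ?_ ?_ ?_ (l + 1) j n hx
  · simpa using this
  · intro n l j z hl _
    simp only [Submodule.mem_iInf, LinearMap.mem_ker]
    intro h0
    obtain ⟨l, rfl⟩ := Nat.exists_eq_succ_of_ne_zero h0
    exact hρ hl
  · intro n l j σ x hx
    simp only [Submodule.mem_iInf, LinearMap.mem_ker] at hx ⊢
    intro hl
    rw [ρ.map_act, hx hl, map_zero]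
  · intro m n p h i l l' j j' f g _ _ hf hg
    simp only [Submodule.mem_iInf, LinearMap.mem_ker] at hf hg ⊢
    intro hl
    rw [ρ.map_comp]
    by_cases h0 : l = 0
    · rw [hg (by omega), map_zero]
    · rw [hf h0, map_zero, LinearMap.zero_apply]

/-- In the arities where a map of collections has a section, so has the map of free operads. -/
theorem tjDeg_le_map_of_lt (φ : E.Map E') (ψ : E'.Map E)
    (hψ : ∀ {l n z}, z ∈ P'.piece l n → ψ.map n z ∈ P.piece l n) {m : ℕ}
    (hφψ : ∀ n < m, ∀ z, φ.map n (ψ.map n z) = z) {n : ℕ} (hn : n < m) (l : ℕ) (j : ℤ) :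
    tjDeg P' l j n ≤ (tjDeg P l j n).map ((mapHom φ).map n) := by
  intro x hx
  have := tjDeg_le (P := P') (fun n l j => ⨅ _ : n < m, (tjDeg P l j n).map ((mapHom φ).map n))
    ?_ ?_ ?_ l j n hx
  · exact Submodule.mem_iInf _ |>.1 this hn
  · intro n l j z hl hj
    simp only [Submodule.mem_iInf]
    intro hn
    exact ⟨ι E n (ψ.map n z), ι_mem_tjDeg (hψ hl) (ψ.map_mem hj), by rw [mapHom_ι, hφψ n hn]⟩
  · intro n l j σ x hx
    simp only [Submodule.mem_iInf] at hx ⊢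
    intro hn
    obtain ⟨y, hy, rfl⟩ := hx hn
    exact ⟨_, act_mem_tjDeg σ hy, (mapHom φ).map_act σ y⟩
  · intro a n p h i l l' j j' f g _ _ hf hg
    simp only [Submodule.mem_iInf] at hf hg ⊢
    intro hp
    have hi := i.2
    -- An inserted operation of arity below two vanishes. Otherwise `n < p`, and `a ≤ p` because `n
    -- ≥ 1`, so both factors have arity less than `m`.
    by_cases ha : a < 2
    · rw [eq_zero_of_lt_two ha f, map_zero, LinearMap.zero_apply]
      exact Submodule.zero_mem _
    obtain ⟨f, hf', rfl⟩ := hf (by omega)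
    obtain ⟨g, hg', rfl⟩ := hg (by omega)
    exact ⟨_, comp_mem_tjDeg h i hf' hg', (mapHom φ).map_comp h i f g⟩

/-- In the next arity, only the generators may fail to come from the smaller collection. -/
theorem tjDeg_le_map_sup (φ : E.Map E') (ψ : E'.Map E)
    (hψ : ∀ {l n z}, z ∈ P'.piece l n → ψ.map n z ∈ P.piece l n) {m : ℕ}
    (hφψ : ∀ n < m, ∀ z, φ.map n (ψ.map n z) = z) (l : ℕ) (j : ℤ) :
    tjDeg P' l j m ≤ (P'.piece l m ⊓ E'.deg m j).map (ι E' m) ⊔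
      (tjDeg P l j m).map ((mapHom φ).map m) := by
  intro x hx
  have := tjDeg_le (P := P') (fun n l j => ⨅ _ : n = m,
    (P'.piece l n ⊓ E'.deg n j).map (ι E' n) ⊔ (tjDeg P l j n).map ((mapHom φ).map n))
    ?_ ?_ ?_ l j m hx
  · exact Submodule.mem_iInf _ |>.1 this rfl
  · intro n l j z hl hj
    simp only [Submodule.mem_iInf]
    intro _
    exact Submodule.mem_sup_left ⟨z, ⟨hl, hj⟩, rfl⟩
  · intro n l j σ x hx
    simp only [Submodule.mem_iInf] at hx ⊢
    intro hn
    obtain ⟨_, ⟨z, hz, rfl⟩, _, ⟨y, hy, rfl⟩, rfl⟩ := Submodule.mem_sup.1 (hx hn)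
    rw [map_add, act_ι, ← (mapHom φ).map_act]
    exact Submodule.add_mem _
      (Submodule.mem_sup_left ⟨_, ⟨P'.act_mem σ hz.1, E'.act_mem σ hz.2⟩, rfl⟩)
      (Submodule.mem_sup_right ⟨_, act_mem_tjDeg σ hy, rfl⟩)
  · intro a n p h i l l' j j' f g hf hg _ _
    simp only [Submodule.mem_iInf]
    intro hp
    have hi := i.2
    -- Here `a + n = m + 1`. Once the vanishing factors of arity below two are excluded, `a` and `n`
    -- are both less than `m`, where all generators come from `E`.
    by_cases ha : a < 2
    · rw [eq_zero_of_lt_two ha f, map_zero, LinearMap.zero_apply]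
      exact Submodule.zero_mem _
    by_cases hn : n < 2
    · rw [eq_zero_of_lt_two hn g, map_zero]
      exact Submodule.zero_mem _
    obtain ⟨f, hf', rfl⟩ := tjDeg_le_map_of_lt φ ψ hψ hφψ (by omega) _ _ hf
    obtain ⟨g, hg', rfl⟩ := tjDeg_le_map_of_lt φ ψ hψ hφψ (by omega) _ _ hg
    exact Submodule.mem_sup_right ⟨_, comp_mem_tjDeg h i hf' hg', (mapHom φ).map_comp h i f g⟩

/-! ### Decomposable elements -/

theorem one_le_length {n : ℕ} (t : Word E n) : 1 ≤ t.length := by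
  induction t with
  | gen j z => rw [Word.length]
  | act σ t ih => rwa [Word.length]
  | comp h i s t hs ht => rw [Word.length]; omega

theorem act_mem_lengthGE {r n : ℕ} (σ : Perm (Fin n)) {x : (freeOperad E).V n}
    (hx : x ∈ lengthGE E r n) : (freeOperad E).act n σ x ∈ lengthGE E r n := by
  have : lengthGE E r n ≤ (lengthGE E r n).comap ((freeOperad E).act n σ) := by
    refine Submodule.span_le.2 ?_
    rintro _ ⟨t, ht, rfl⟩
    exact Submodule.subset_span ⟨Word.act σ t, ht, (act_word σ t).symm⟩
  exact this hx

theorem comp_mem_lengthGE_two {m n p : ℕ} (h : p + 1 = m + n) (i : Fin n)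
    (f : (freeOperad E).V m) (g : (freeOperad E).V n) :
    (freeOperad E).comp h i f g ∈ lengthGE E 2 p := by
  refine word_induction (P := fun f => (freeOperad E).comp h i f g ∈ lengthGE E 2 p) f
    (by simp) ?_ ?_ fun s => ?_
  · intro a b ha hb; rw [map_add]; exact Submodule.add_mem _ ha hb
  · intro c a ha; rw [map_smul]; exact Submodule.smul_mem _ c ha
  refine word_induction (P := fun g => (freeOperad E).comp h i (word s) g ∈ lengthGE E 2 p) g
    (by simp) ?_ ?_ fun t => ?_
  · intro a b ha hb; rw [map_add]; exact Submodule.add_mem _ ha hb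
  · intro c a ha; rw [map_smul]; exact Submodule.smul_mem _ c ha
  refine Submodule.subset_span ⟨Word.comp h i s t, ?_, (comp_word h i s t).symm⟩
  have := one_le_length s
  have := one_le_length t
  rw [Word.length]
  omega

/-- A homomorphism of free operads takes decomposable values in an arity without generators. -/
theorem hom_mem_lengthGE_two (φ : Operad.Hom (freeOperad E) (freeOperad E')) {n : ℕ}
    (hn : Subsingleton (E.V n)) (x : (freeOperad E).V n) : φ.map n x ∈ lengthGE E' 2 n := by
  refine word_induction (P := fun x => φ.map n x ∈ lengthGE E' 2 n) x (by simp) ?_ ?_ fun t => ?_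
  · intro a b ha hb; rw [map_add]; exact Submodule.add_mem _ ha hb
  · intro c a ha; rw [map_smul]; exact Submodule.smul_mem _ c ha
  clear x
  induction t with
  | gen j z =>
    rw [← ι_of_mem, hn.elim (z : E.V _) 0, map_zero, map_zero]
    exact Submodule.zero_mem _
  | act σ t ih => rw [← act_word, φ.map_act]; exact act_mem_lengthGE σ (ih hn)
  | comp h i s t _ _ => rw [← comp_word, φ.map_comp]; exact comp_mem_lengthGE_two h i _ _

end FreeOperad

/-! ### Invariant complements -/

/-- Maschke's theorem, for a pair of invariant subspaces. -/
theorem exists_invariant_compl {k : Type u} [Field k] [CharZero k] {G : Type*} [Group G]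
    [Fintype G] {M : Type v} [AddCommGroup M] [Module k M] (ρ : G →* Module.End k M)
    {A B : Submodule k M} (hAB : A ≤ B) (hA : ∀ g, ∀ x ∈ A, ρ g x ∈ A)
    (hB : ∀ g, ∀ x ∈ B, ρ g x ∈ B) :
    ∃ C ≤ B, (∀ g, ∀ x ∈ C, ρ g x ∈ C) ∧ A ⊓ C = ⊥ ∧ B ≤ A ⊔ C := by
  obtain ⟨p, hp⟩ := A.subtype.exists_leftInverse_of_injective A.ker_subtype
  have hp' : ∀ x ∈ A, (p x : M) = x := fun x hx =>
    congrArg Subtype.val (LinearMap.congr_fun hp ⟨x, hx⟩)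
  have hcard : (Fintype.card G : k) ≠ 0 := Nat.cast_ne_zero.2 Fintype.card_ne_zero
  -- Average over the group of the conjugates of a linear projection onto `A`: an equivariant
  -- projection onto `A`.
  let q : M →ₗ[k] M := (Fintype.card G : k)⁻¹ • ∑ g, ρ g ∘ₗ A.subtype ∘ₗ p ∘ₗ ρ g⁻¹
  have hq : ∀ x, q x = (Fintype.card G : k)⁻¹ • ∑ g, ρ g (p (ρ g⁻¹ x)) := fun x => by
    simp [q, LinearMap.sum_apply]
  have hinv : ∀ g x, ρ g (ρ g⁻¹ x) = x := fun g x => by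
    rw [← Module.End.mul_apply, ← map_mul, mul_inv_cancel, map_one, Module.End.one_apply]
  have hqA : ∀ x, q x ∈ A := fun x => by
    rw [hq]
    exact Submodule.smul_mem _ _ (Submodule.sum_mem _ fun g _ => hA g _ (p _).2)
  have hqid : ∀ x ∈ A, q x = x := fun x hx => by
    have : ∀ g, ρ g (p (ρ g⁻¹ x)) = x := fun g => by rw [hp' _ (hA _ x hx), hinv]
    rw [hq, Finset.sum_congr rfl fun g _ => this g, Finset.sum_const, Finset.card_univ,
      ← Nat.cast_smul_eq_nsmul k, smul_smul, inv_mul_cancel₀ hcard, one_smul]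
  have hqact : ∀ g x, q (ρ g x) = ρ g (q x) := fun g x => by
    rw [hq, hq, map_smul, map_sum]
    congr 1
    rw [← Equiv.sum_comp (Equiv.mulLeft g)]
    refine Finset.sum_congr rfl fun h _ => ?_
    simp only [Equiv.coe_mulLeft, mul_inv_rev, map_mul, Module.End.mul_apply]
    have : ρ g⁻¹ (ρ g x) = x := by simp
    rw [this]
  -- The kernel of `q` is invariant because `q` is equivariant. As `A ≤ B`, the splitting `x = q x +
  -- (x - q x)` stays inside `B`.
  refine ⟨B ⊓ LinearMap.ker q, inf_le_left, fun g x hx => ⟨hB g x hx.1, ?_⟩, ?_, fun x hx => ?_⟩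
  · have h0 : q x = 0 := hx.2
    change q (ρ g x) = 0
    rw [hqact, h0, map_zero]
  · rw [eq_bot_iff]
    rintro x ⟨hxA, -, hx⟩
    have h0 : q x = 0 := hx
    rw [Submodule.mem_bot, ← hqid x hxA, h0]
  · rw [← add_sub_cancel (q x) x]
    refine Submodule.add_mem_sup (hqA x) ⟨Submodule.sub_mem _ hx (hAB (hqA x)), ?_⟩
    change q (x - q x) = 0
    rw [map_sub, hqid _ (hqA x), sub_self]

/-! ### Direct sums of families -/

section FiberSubmodule

variable {k : Type u} [Field k] {I : Type} {κ : Type*} {M : I → Type v}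
  [∀ i, AddCommGroup (M i)] [∀ i, Module k (M i)]

/-- The elements of a direct sum supported on a fibre of a map on the index set. -/
def fiberSubmodule (k : Type u) [Field k] {I : Type} {κ : Type*} (M : I → Type v)
    [∀ i, AddCommGroup (M i)] [∀ i, Module k (M i)] (f : I → κ) (a : κ) :
    Submodule k (Π₀ i, M i) where
  carrier := {x | ∀ i, f i ≠ a → x i = 0}
  zero_mem' _ _ := rfl
  add_mem' hx hy i hi := by rw [DFinsupp.add_apply, hx i hi, hy i hi, add_zero]
  smul_mem' c x hx i hi := by rw [DFinsupp.smul_apply, hx i hi, smul_zero]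

variable {f : I → κ}

theorem single_mem_fiberSubmodule [DecidableEq I] (i : I) (y : M i) :
    DFinsupp.single i y ∈ fiberSubmodule k M f (f i) := fun _ hi' =>
  DFinsupp.single_eq_of_ne fun h => hi' (congrArg f h)

/-- A linear map on a direct sum maps the elements supported on a fibre to a subspace if it does
so on the corresponding summands. -/
theorem lsum_mem_of_mem_fiberSubmodule [DecidableEq I] {N : Type w} [AddCommGroup N] [Module k N]
    {S : Submodule k N} {a : κ} {L : ∀ i, M i →ₗ[k] N} (h : ∀ i, f i = a → ∀ y, L i y ∈ S)
    {x : Π₀ i, M i} (hx : x ∈ fiberSubmodule k M f a) : DFinsupp.lsum ℕ L x ∈ S := by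
  classical
  rw [DFinsupp.lsum_apply_apply, DFinsupp.sumAddHom_apply]
  refine Submodule.sum_mem _ fun i _ => ?_
  by_cases hi : f i = a
  · exact h i hi _
  · rw [hx i hi]
    change L i 0 ∈ S
    rw [map_zero]
    exact Submodule.zero_mem _

/-- With `A` and `B` the actions of a permutation, this yields the equivariance of maps given
summand by summand on the generators. -/
theorem lsum_mapRange [DecidableEq I] {N : Type w} [AddCommGroup N] [Module k N]
    (L : ∀ i, M i →ₗ[k] N) (A : ∀ i, M i →ₗ[k] M i) (B : N →ₗ[k] N)
    (h : ∀ i y, L i (A i y) = B (L i y)) (x : Π₀ i, M i) :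
    DFinsupp.lsum ℕ L (DFinsupp.mapRange.linearMap A x) = B (DFinsupp.lsum ℕ L x) := by
  refine LinearMap.congr_fun (f := DFinsupp.lsum ℕ L ∘ₗ DFinsupp.mapRange.linearMap A)
    (g := B ∘ₗ DFinsupp.lsum ℕ L) (DFinsupp.lhom_ext fun i y => ?_) x
  simp [h]

theorem DFinsupp.map_lsum [DecidableEq I] {N N' : Type w} [AddCommGroup N] [Module k N]
    [AddCommGroup N'] [Module k N'] (B : N →ₗ[k] N') (L : ∀ i, M i →ₗ[k] N) (x : Π₀ i, M i) :
    B (DFinsupp.lsum ℕ L x) = DFinsupp.lsum ℕ (fun i => B ∘ₗ L i) x := by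
  refine LinearMap.congr_fun (f := B ∘ₗ DFinsupp.lsum ℕ L)
    (g := DFinsupp.lsum ℕ fun i => B ∘ₗ L i) (DFinsupp.lhom_ext fun i y => ?_) x
  simp

theorem lsum_mem [DecidableEq I] {N : Type w} [AddCommGroup N] [Module k N]
    {S : Submodule k N} {L : ∀ i, M i →ₗ[k] N} (h : ∀ i y, L i y ∈ S) (x : Π₀ i, M i) :
    DFinsupp.lsum ℕ L x ∈ S :=
  -- A constant map has only one fibre, so the support condition is empty.
  lsum_mem_of_mem_fiberSubmodule (f := fun _ => ()) (a := ()) (fun i _ => h i)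
    fun _ hi => absurd rfl hi

theorem fiberSubmodule_isInternal [DecidableEq I] [DecidableEq κ] :
    DirectSum.IsInternal (fiberSubmodule k M f) := by
  classical
  apply DirectSum.isInternal_submodule_of_iSupIndep_of_iSup_eq_top
  · intro a
    rw [Submodule.disjoint_def]
    intro x hx hx'
    ext i
    by_cases hi : f i = a
    · have : ⨆ b, ⨆ (_ : b ≠ a), fiberSubmodule k M f b ≤ LinearMap.ker (DFinsupp.lapply i) :=
        iSup_le fun b => iSup_le fun hb y hy => hy i (by rw [hi]; exact hb.symm)
      exact this hx'
    · exact hx i hi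
  · rw [eq_top_iff]
    intro x _
    rw [← DFinsupp.sum_single (f := x)]
    exact Submodule.sum_mem _ fun i _ =>
      Submodule.mem_iSup_of_mem (f i) (single_mem_fiberSubmodule i _)

variable {J : Type} [DecidableEq I] [DecidableEq J] (e : J → I)

/-- The inclusion of the direct sum of a subfamily. -/
def DFinsupp.extendLin (k : Type u) [Field k] {I J : Type} [DecidableEq I] [DecidableEq J]
    (M : I → Type v) [∀ i, AddCommGroup (M i)] [∀ i, Module k (M i)] (e : J → I) :
    (Π₀ i, M (e i)) →ₗ[k] Π₀ i, M i :=
  DFinsupp.lsum ℕ fun i => DFinsupp.lsingle (e i)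

/-- The projection onto the direct sum of a subfamily. -/
noncomputable def DFinsupp.comapLin (k : Type u) [Field k] {I J : Type} (M : I → Type v)
    [∀ i, AddCommGroup (M i)] [∀ i, Module k (M i)] (e : J → I) (he : Function.Injective e) :
    (Π₀ i, M i) →ₗ[k] Π₀ i, M (e i) where
  toFun := DFinsupp.comapDomain e he
  map_add' := DFinsupp.comapDomain_add e he
  map_smul' := DFinsupp.comapDomain_smul e he

theorem DFinsupp.extendLin_single (i : J) (y : M (e i)) :
    DFinsupp.extendLin k M e (DFinsupp.single (β := fun i => M (e i)) i y) =
      DFinsupp.single (e i) y := by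
  simp [DFinsupp.extendLin]

theorem DFinsupp.lsum_extendLin {N : Type w} [AddCommGroup N] [Module k N]
    (L : ∀ i, M i →ₗ[k] N) (x : Π₀ i, M (e i)) :
    DFinsupp.lsum ℕ L (DFinsupp.extendLin k M e x) = DFinsupp.lsum ℕ (fun i => L (e i)) x := by
  refine LinearMap.congr_fun (f := DFinsupp.lsum ℕ L ∘ₗ DFinsupp.extendLin k M e)
    (g := DFinsupp.lsum ℕ fun i => L (e i)) (DFinsupp.lhom_ext fun i y => ?_) x
  simp [DFinsupp.extendLin_single]

theorem DFinsupp.comapLin_single (he : Function.Injective e) (i : J) (y : M (e i)) :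
    DFinsupp.comapLin k M e he (DFinsupp.single (e i) y) =
      DFinsupp.single (β := fun i => M (e i)) i y :=
  DFinsupp.comapDomain_single e he i y

theorem DFinsupp.comapLin_extendLin (he : Function.Injective e) (x : Π₀ i, M (e i)) :
    DFinsupp.comapLin k M e he (DFinsupp.extendLin k M e x) = x := by
  refine LinearMap.congr_fun (f := DFinsupp.comapLin k M e he ∘ₗ DFinsupp.extendLin k M e)
    (g := LinearMap.id) (DFinsupp.lhom_ext fun i y => ?_) x
  rw [LinearMap.comp_apply, DFinsupp.extendLin_single, DFinsupp.comapLin_single,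
    LinearMap.id_apply]

theorem DFinsupp.extendLin_comapLin (he : Function.Injective e)
    (h : ∀ i, i ∉ Set.range e → Subsingleton (M i)) (x : Π₀ i, M i) :
    DFinsupp.extendLin k M e (DFinsupp.comapLin k M e he x) = x := by
  refine LinearMap.congr_fun (f := DFinsupp.extendLin k M e ∘ₗ DFinsupp.comapLin k M e he)
    (g := LinearMap.id) (DFinsupp.lhom_ext fun i y => ?_) x
  by_cases hi : i ∈ Set.range e
  · obtain ⟨i, rfl⟩ := hi
    rw [LinearMap.comp_apply, DFinsupp.comapLin_single, DFinsupp.extendLin_single,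
      LinearMap.id_apply]
  · have := h i hi
    rw [Subsingleton.elim y 0, DFinsupp.single_zero, map_zero, map_zero]

theorem DFinsupp.extendLin_mem_fiberSubmodule {x : Π₀ i, M (e i)} {a : κ}
    (hx : x ∈ fiberSubmodule k (fun i => M (e i)) (fun i => f (e i)) a) :
    DFinsupp.extendLin k M e x ∈ fiberSubmodule k M f a := by
  refine lsum_mem_of_mem_fiberSubmodule (fun i hi y => ?_) hx
  rw [← hi]
  exact single_mem_fiberSubmodule (e i) y

theorem DFinsupp.extendLin_mapRange (A : ∀ i, M i →ₗ[k] M i) (x : Π₀ i, M (e i)) :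
    DFinsupp.extendLin k M e (DFinsupp.mapRange.linearMap (fun i => A (e i)) x) =
      DFinsupp.mapRange.linearMap A (DFinsupp.extendLin k M e x) :=
  lsum_mapRange _ _ _ (fun i y => by simp) x

end FiberSubmodule

/-! ### Collections from families, direct sums, and maps of decomposed collections -/

namespace Collection

variable {k : Type u} [Field k]

section OfFamily

variable {I : Type} [DecidableEq I] (M : I → ℕ → Type v) [∀ i n, AddCommGroup (M i n)]
  [∀ i n, Module k (M i n)] (act : ∀ i n, Perm (Fin n) →* Module.End k (M i n)) (l : I → ℕ)
  (j : I → ℤ) (hM : ∀ i n, n < 2 → Subsingleton (M i n))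

/-- The direct sum of a family of sequences of representations, each of a fixed degree. -/
def ofFamily : Collection.{u, v} k where
  V n := Π₀ i, M i n
  act n :=
    { toFun := fun σ => DFinsupp.mapRange.linearMap fun i => act i n σ
      map_one' := by ext; simp
      map_mul' := fun σ τ => by ext; simp }
  deg n d := fiberSubmodule k (fun i => M i n) j d
  isInternal n := fiberSubmodule_isInternal
  act_mem {n} σ d x hx i hi := by
    change act i n σ (x i) = 0
    rw [hx i hi, map_zero]
  subsingleton_of_lt_two n hn := by
    have := fun i => hM i n hn
    exact ⟨fun x y => DFinsupp.ext fun i => Subsingleton.elim _ _⟩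

/-- The decomposition of `ofFamily` by a labelling of the family. -/
def ofFamilyDecomposition : (ofFamily M act j hM).Decomposition where
  piece d n := fiberSubmodule k (fun i => M i n) l d
  isInternal n := fiberSubmodule_isInternal
  act_mem {d n} σ (x : Π₀ i, M i n) hx i hi := by
    change act i n σ (x i) = 0
    rw [hx i hi, map_zero]
  le_iSup_inf_deg d n := by
    classical
    intro (x : Π₀ i, M i n) hx
    rw [← DFinsupp.sum_single (f := x)]
    refine Submodule.sum_mem _ fun i _ => ?_
    by_cases hi : l i = d
    · refine Submodule.mem_iSup_of_mem (j i) ⟨?_, single_mem_fiberSubmodule i _⟩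
      rw [← hi]
      exact single_mem_fiberSubmodule i _
    · rw [hx i hi, DFinsupp.single_zero]
      exact Submodule.zero_mem _

end OfFamily

/-- The direct sum of two collections. -/
def prod (E E' : Collection.{u, v} k) : Collection.{u, v} k where
  V n := E.V n × E'.V n
  act n :=
    { toFun := fun σ => (E.act n σ).prodMap (E'.act n σ)
      map_one' := by ext <;> simp
      map_mul' := fun σ τ => by ext <;> simp }
  deg n j := (E.deg n j).prod (E'.deg n j)
  isInternal n := (E.isInternal n).submodule_prod (E'.isInternal n)
  act_mem σ _ _ hx := ⟨E.act_mem σ hx.1, E'.act_mem σ hx.2⟩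
  subsingleton_of_lt_two n hn := by
    have := E.subsingleton_of_lt_two n hn
    have := E'.subsingleton_of_lt_two n hn
    infer_instance

variable {E E' : Collection.{u, v} k}

/-- The decomposition of the direct sum of two decomposed collections. -/
def Decomposition.prod (P : E.Decomposition) (P' : E'.Decomposition) :
    (E.prod E').Decomposition where
  piece l n := (P.piece l n).prod (P'.piece l n)
  isInternal n := (P.isInternal n).submodule_prod (P'.isInternal n)
  act_mem σ _ hx := ⟨P.act_mem σ hx.1, P'.act_mem σ hx.2⟩
  le_iSup_inf_deg l n := by
    rintro ⟨x, y⟩ ⟨hx, hy⟩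
    have h1 : P.piece l n ≤ (⨆ j, (P.piece l n).prod (P'.piece l n) ⊓
        (E.deg n j).prod (E'.deg n j)).comap (LinearMap.inl k (E.V n) (E'.V n)) :=
      (P.le_iSup_inf_deg l n).trans <| iSup_le fun j z hz => Submodule.mem_iSup_of_mem j
        ⟨⟨hz.1, Submodule.zero_mem _⟩, hz.2, Submodule.zero_mem _⟩
    have h2 : P'.piece l n ≤ (⨆ j, (P.piece l n).prod (P'.piece l n) ⊓
        (E.deg n j).prod (E'.deg n j)).comap (LinearMap.inr k (E.V n) (E'.V n)) :=
      (P'.le_iSup_inf_deg l n).trans <| iSup_le fun j z hz => Submodule.mem_iSup_of_mem j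
        ⟨⟨Submodule.zero_mem _, hz.1⟩, Submodule.zero_mem _, hz.2⟩
    have := Submodule.add_mem _ (Submodule.mem_comap.1 (h1 hx)) (Submodule.mem_comap.1 (h2 hy))
    rw [LinearMap.inl_apply, LinearMap.inr_apply, Prod.mk_add_mk, add_zero, zero_add] at this
    exact this

/-- A map of decomposed collections. -/
structure Decomposition.Map (P : E.Decomposition) (P' : E'.Decomposition) extends
    Collection.Map E E' where
  map_piece : ∀ {l n : ℕ} {x : E.V n}, x ∈ P.piece l n → map n x ∈ P'.piece l n

namespace Decomposition.Map

variable {E'' : Collection.{u, v} k} {P : E.Decomposition} {P' : E'.Decomposition}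
  {P'' : E''.Decomposition}

/-- The zero map. -/
def zero (P : E.Decomposition) (P' : E'.Decomposition) : Map P P' where
  map _ := 0
  map_mem _ := Submodule.zero_mem _
  map_act _ _ := by simp
  map_piece _ := Submodule.zero_mem _

/-- The map from a direct sum with given components. -/
def coprod (φ : Map P P'') (φ' : Map P' P'') : Map (P.prod P') P'' where
  map n := (φ.map n).coprod (φ'.map n)
  map_mem hx := Submodule.add_mem _ (φ.map_mem hx.1) (φ'.map_mem hx.2)
  map_act {n} σ x := by
    change φ.map n (E.act n σ x.1) + φ'.map n (E'.act n σ x.2) =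
      E''.act n σ (φ.map n x.1 + φ'.map n x.2)
    rw [φ.map_act, φ'.map_act, map_add]
  map_piece hx := Submodule.add_mem _ (φ.map_piece hx.1) (φ'.map_piece hx.2)

/-- The map to a direct sum with given components. -/
def prodMk (φ : Map P'' P) (φ' : Map P'' P') : Map P'' (P.prod P') where
  map n := (φ.map n).prod (φ'.map n)
  map_mem hx := ⟨φ.map_mem hx, φ'.map_mem hx⟩
  map_act σ x := Prod.ext (φ.map_act σ x) (φ'.map_act σ x)
  map_piece hx := ⟨φ.map_piece hx, φ'.map_piece hx⟩

/-- The inclusion of the first summand. -/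
def inl (P : E.Decomposition) (P' : E'.Decomposition) : Map P (P.prod P') where
  map n := LinearMap.inl k (E.V n) (E'.V n)
  map_mem hx := ⟨hx, Submodule.zero_mem _⟩
  map_act {n} σ _ := Prod.ext rfl (map_zero (E'.act n σ)).symm
  map_piece hx := ⟨hx, Submodule.zero_mem _⟩

section OfFamily

variable {I J : Type} [DecidableEq I] [DecidableEq J] (M : I → ℕ → Type v)
  [∀ i n, AddCommGroup (M i n)] [∀ i n, Module k (M i n)]
  (act : ∀ i n, Perm (Fin n) →* Module.End k (M i n)) (l : I → ℕ)
  (j : I → ℤ) (hM : ∀ i n, n < 2 → Subsingleton (M i n)) (e : J → I)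

/-- The inclusion of a subfamily. -/
def extend :
    Map (ofFamilyDecomposition (fun i => M (e i)) (fun i => act (e i)) (fun i => l (e i))
      (fun i => j (e i)) fun i => hM (e i)) (ofFamilyDecomposition M act l j hM) where
  map n := DFinsupp.extendLin k (fun i => M i n) e
  map_mem {n d x} hx :=
    DFinsupp.extendLin_mem_fiberSubmodule (M := fun i => M i n) (f := j) (a := d) e (x := x) hx
  map_act {n} σ x := DFinsupp.extendLin_mapRange e (fun i => act i n σ) x
  map_piece {d n x} hx :=
    DFinsupp.extendLin_mem_fiberSubmodule (M := fun i => M i n) (f := l) (a := d) e (x := x) hx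

/-- The projection onto a subfamily. -/
noncomputable def restrict (he : Function.Injective e) :
    Map (ofFamilyDecomposition M act l j hM) (ofFamilyDecomposition (fun i => M (e i))
      (fun i => act (e i)) (fun i => l (e i)) (fun i => j (e i)) fun i => hM (e i)) where
  map n := DFinsupp.comapLin k (fun i => M i n) e he
  map_mem hx i hi := hx (e i) hi
  map_act _ _ := DFinsupp.ext fun _ => rfl
  map_piece hx i hi := hx (e i) hi

theorem restrict_extend (he : Function.Injective e) (n : ℕ)
    (x : (ofFamily (fun i => M (e i)) (fun i => act (e i)) (fun i => j (e i))
      fun i => hM (e i)).V n) :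
    (restrict M act l j hM e he).map n ((extend M act l j hM e).map n x) = x :=
  DFinsupp.comapLin_extendLin (k := k) (M := fun i => M i n) e he x

theorem extend_restrict (he : Function.Injective e) (n : ℕ)
    (h : ∀ i, i ∉ Set.range e → Subsingleton (M i n)) (x : (ofFamily M act j hM).V n) :
    (extend M act l j hM e).map n ((restrict M act l j hM e he).map n x) = x :=
  DFinsupp.extendLin_comapLin (k := k) (M := fun i => M i n) e he h x

end OfFamily

end Decomposition.Map

end Collection

/-! ### The construction of the model, arity by arity -/

/-- A decomposed collection, with a map `δ` defining a derivation of degree `-1` of the free operad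
and a map `r` defining a homomorphism from the free operad to `H`. -/
structure QuasiFreeData {k : Type u} [Field k] (H : Operad.{u, v} k) where
  Z : Collection.{u, max u v} k
  P : Z.Decomposition
  δ : ∀ n, Z.V n →ₗ[k] (freeOperad Z).V n
  δ_mem : ∀ n j x, x ∈ Z.deg n j → δ n x ∈ (freeOperad Z).deg n (j + -1)
  δ_act : ∀ n σ x, δ n (Z.act n σ x) = (freeOperad Z).act n σ (δ n x)
  r : ∀ n, Z.V n →ₗ[k] H.V n
  r_mem : ∀ n j x, x ∈ Z.deg n j → r n x ∈ H.deg n j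
  r_act : ∀ n σ x, r n (Z.act n σ x) = H.act n σ (r n x)

namespace QuasiFreeData

open FreeOperad Collection

variable {k : Type u} [Field k] {H : Operad.{u, v} k} (M : QuasiFreeData H)

/-- The free operad on the generators. -/
noncomputable abbrev F : Operad.{u, max u v} k := freeOperad M.Z

/-- The derivation determined by `δ`. -/
noncomputable def d : Operad.Derivation M.F (-1) := derivation M.δ M.δ_mem M.δ_act

/-- The homomorphism determined by `r`. -/
noncomputable def ρ : Operad.Hom M.F H := lift M.r M.r_mem M.r_act

@[simp] theorem d_ι (n : ℕ) (z : M.Z.V n) : M.d.map n (ι M.Z n z) = M.δ n z :=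
  derivation_ι _ _ _ n z

@[simp] theorem ρ_ι (n : ℕ) (z : M.Z.V n) : M.ρ.map n (ι M.Z n z) = M.r n z :=
  lift_ι _ _ _ n z

/-- The action on the terms of the cone of `ρ`. -/
noncomputable def coneAct (n : ℕ) : Perm (Fin n) →* Module.End k (M.F.V n × H.V n) where
  toFun σ := (M.F.act n σ).prodMap (H.act n σ)
  map_one' := by ext <;> simp
  map_mul' σ τ := by ext <;> simp

/-- The differential of the cone of `ρ`. -/
noncomputable def coneMap (n : ℕ) : M.F.V n →ₗ[k] M.F.V n × H.V n := (M.d.map n).prod (M.ρ.map n)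

theorem coneMap_act (n : ℕ) (σ : Perm (Fin n)) (x : M.F.V n) :
    M.coneMap n (M.F.act n σ x) = M.coneAct n σ (M.coneMap n x) :=
  Prod.ext (M.d.map_act σ x) (M.ρ.map_act σ x)

/-- The component of the free operad in which the generators of TJ-degree `l` and degree `j` have
their boundary. -/
noncomputable def boundaryTarget (n : ℕ) : ℕ → ℤ → Submodule k (M.F.V n)
  | 0, _ => ⊥
  | l + 1, j => tjDeg M.P l (j + -1) n

/-- The subspace of `H` in which the generators of TJ-degree `l` and degree `j` have their
image. -/
def imageTarget (H : Operad.{u, v} k) (n : ℕ) : ℕ → ℤ → Submodule k (H.V n)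
  | 0, j => H.deg n j
  | _ + 1, _ => ⊥

/-- The cycles of bidegree `(l, j)` of the cone of `ρ`. -/
noncomputable def coneCycles (n : ℕ) (i : ℕ × ℤ) : Submodule k (M.F.V n × H.V n) :=
  (M.boundaryTarget n i.1 i.2 ⊓ LinearMap.ker (M.d.map n) ⊓ LinearMap.ker (M.ρ.map n)).prod
    (imageTarget H n i.1 i.2)

theorem boundaryTarget_le_deg (n l : ℕ) (j : ℤ) :
    M.boundaryTarget n l j ≤ M.F.deg n (j + -1) := by
  cases l with
  | zero => exact bot_le
  | succ l => exact tjDeg_le_deg l _ n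

theorem imageTarget_le_deg (n l : ℕ) (j : ℤ) : imageTarget H n l j ≤ H.deg n j := by
  cases l with
  | zero => exact le_rfl
  | succ l => exact bot_le

theorem coneCycles_act {n : ℕ} {i : ℕ × ℤ} (σ : Perm (Fin n)) {x : M.F.V n × H.V n}
    (hx : x ∈ M.coneCycles n i) : M.coneAct n σ x ∈ M.coneCycles n i := by
  obtain ⟨⟨⟨h1, h2⟩, h3⟩, h4⟩ := hx
  refine ⟨⟨⟨?_, ?_⟩, ?_⟩, ?_⟩
  · change M.F.act n σ x.1 ∈ _
    obtain ⟨_ | l, j⟩ := i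
    · have h0 : x.1 = 0 := h1
      rw [h0, map_zero]
      exact Submodule.zero_mem _
    · exact act_mem_tjDeg σ h1
  · have h0 : M.d.map n x.1 = 0 := h2
    exact (M.d.map_act σ x.1).trans (by rw [h0, map_zero])
  · have h0 : M.ρ.map n x.1 = 0 := h3
    exact (M.ρ.map_act σ x.1).trans (by rw [h0, map_zero])
  · change H.act n σ x.2 ∈ _
    obtain ⟨_ | l, j⟩ := i
    · exact H.act_mem σ h4
    · have h0 : x.2 = 0 := h4
      rw [h0, map_zero]
      exact Submodule.zero_mem _

variable [CharZero k]

/-- Maschke's theorem is applied to the cone boundaries that happen to lie in `coneCycles`, since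
the range of `coneMap` need not be contained there. As `C` consists of such cycles, it is disjoint
from the whole range and not merely from this intersection. -/
theorem exists_newGens (n : ℕ) (i : ℕ × ℤ) :
    ∃ C ≤ M.coneCycles n i, (∀ σ, ∀ x ∈ C, M.coneAct n σ x ∈ C) ∧
      LinearMap.range (M.coneMap n) ⊓ C = ⊥ ∧
      M.coneCycles n i ≤ LinearMap.range (M.coneMap n) ⊔ C := by
  obtain ⟨C, hC, hact, hdisj, hsup⟩ := exists_invariant_compl (M.coneAct n)
    (A := M.coneCycles n i ⊓ LinearMap.range (M.coneMap n)) (B := M.coneCycles n i) inf_le_left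
    (fun σ x hx => ⟨M.coneCycles_act σ hx.1, by
      obtain ⟨y, rfl⟩ := hx.2
      exact ⟨_, M.coneMap_act n σ y⟩⟩) (fun σ x hx => M.coneCycles_act σ hx)
  refine ⟨C, hC, hact, ?_, hsup.trans (sup_le_sup_right inf_le_right C)⟩
  rw [eq_bot_iff, ← hdisj]
  exact fun x hx => ⟨⟨hC hx.2, hx.1⟩, hx.2⟩

/-- The new generators of bidegree `i`: in arity `a`, an invariant complement of the boundaries in
the cycles of the cone of `ρ`. -/
noncomputable def newGens (a n : ℕ) (i : ℕ × ℤ) : Submodule k (M.F.V n × H.V n) :=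
  -- The condition `n = a` concentrates the new generators in one arity; `2 ≤ n` makes them a
  -- collection.
  open Classical in if n = a ∧ 2 ≤ n then (M.exists_newGens n i).choose else ⊥

theorem newGens_le (a n : ℕ) (i : ℕ × ℤ) : M.newGens a n i ≤ M.coneCycles n i := by
  unfold newGens
  split_ifs
  · exact (M.exists_newGens n i).choose_spec.1
  · exact bot_le

theorem newGens_act {a n : ℕ} {i : ℕ × ℤ} (σ : Perm (Fin n)) {x : M.F.V n × H.V n}
    (hx : x ∈ M.newGens a n i) : M.coneAct n σ x ∈ M.newGens a n i := by
  unfold newGens at hx ⊢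
  split_ifs at hx ⊢
  · exact (M.exists_newGens n i).choose_spec.2.1 σ x hx
  · rw [(Submodule.mem_bot k).1 hx, map_zero]
    exact Submodule.zero_mem _

/-- Half of the complement property: a new generator never combines with old elements to form a new
cycle killed by `ρ`. -/
theorem eq_zero_of_mem_newGens {a n : ℕ} {i : ℕ × ℤ} {x : M.F.V n × H.V n}
    (hx : x ∈ M.newGens a n i) (hx' : x ∈ LinearMap.range (M.coneMap n)) : x = 0 := by
  unfold newGens at hx
  split_ifs at hx
  · have := (M.exists_newGens n i).choose_spec.2.2.1
    exact (Submodule.mem_bot k).1 (this ▸ ⟨hx', hx⟩)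
  · exact (Submodule.mem_bot k).1 hx

/-- The other half: once the new generators are added, every old cycle killed by `ρ` bounds, and
every element of `H` of this arity is reached. -/
theorem coneCycles_le (n : ℕ) (hn : 2 ≤ n) (i : ℕ × ℤ) :
    M.coneCycles n i ≤ LinearMap.range (M.coneMap n) ⊔ M.newGens n n i := by
  unfold newGens
  rw [if_pos ⟨rfl, hn⟩]
  exact (M.exists_newGens n i).choose_spec.2.2.2

theorem newGens_subsingleton {a n : ℕ} (h : n ≠ a ∨ n < 2) (i : ℕ × ℤ) :
    Subsingleton (M.newGens a n i) := by
  unfold newGens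
  rw [if_neg (by omega)]
  infer_instance

/-- The action on the new generators. -/
noncomputable def newGensAct (a n : ℕ) (i : ℕ × ℤ) :
    Perm (Fin n) →* Module.End k (M.newGens a n i) where
  toFun σ := (M.coneAct n σ).restrict fun _ hx => M.newGens_act σ hx
  map_one' := by ext x <;> simp
  map_mul' σ τ := by ext x <;> simp

/-- The collection of new generators. -/
noncomputable abbrev newColl (a : ℕ) : Collection.{u, max u v} k :=
  ofFamily (fun i n => M.newGens a n i) (fun i n => M.newGensAct a n i) Prod.snd
    fun i _ hn => M.newGens_subsingleton (Or.inr hn) i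

/-- The decomposition of the collection of new generators. -/
noncomputable abbrev newDecomp (a : ℕ) : (M.newColl a).Decomposition :=
  ofFamilyDecomposition (fun i n => M.newGens a n i) (fun i n => M.newGensAct a n i) Prod.fst
    Prod.snd fun i _ hn => M.newGens_subsingleton (Or.inr hn) i

theorem newColl_subsingleton {a n : ℕ} (h : n ≠ a) : Subsingleton ((M.newColl a).V n) := by
  have := fun i => M.newGens_subsingleton (Or.inl h) i
  exact ⟨fun x y => DFinsupp.ext fun i => Subsingleton.elim _ _⟩

/-- The boundaries of the new generators. -/
noncomputable def newδ (a n : ℕ) : (M.newColl a).V n →ₗ[k] M.F.V n :=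
  DFinsupp.lsum ℕ fun i => LinearMap.fst k _ _ ∘ₗ (M.newGens a n i).subtype

/-- The images in `H` of the new generators. -/
noncomputable def newR (a n : ℕ) : (M.newColl a).V n →ₗ[k] H.V n :=
  DFinsupp.lsum ℕ fun i => LinearMap.snd k _ _ ∘ₗ (M.newGens a n i).subtype

theorem newδ_act (a n : ℕ) (σ : Perm (Fin n)) (x : (M.newColl a).V n) :
    M.newδ a n ((M.newColl a).act n σ x) = M.F.act n σ (M.newδ a n x) :=
  lsum_mapRange (fun i => LinearMap.fst k _ _ ∘ₗ (M.newGens a n i).subtype)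
    (fun i => M.newGensAct a n i σ) (M.F.act n σ) (fun _ _ => rfl) x

theorem newR_act (a n : ℕ) (σ : Perm (Fin n)) (x : (M.newColl a).V n) :
    M.newR a n ((M.newColl a).act n σ x) = H.act n σ (M.newR a n x) :=
  lsum_mapRange (fun i => LinearMap.snd k _ _ ∘ₗ (M.newGens a n i).subtype)
    (fun i => M.newGensAct a n i σ) (H.act n σ) (fun _ _ => rfl) x

theorem newδ_mem {a n : ℕ} {j : ℤ} {x : (M.newColl a).V n} (hx : x ∈ (M.newColl a).deg n j) :
    M.newδ a n x ∈ M.F.deg n (j + -1) := by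
  refine lsum_mem_of_mem_fiberSubmodule (fun i hi y => ?_) hx
  rw [← hi]
  exact M.boundaryTarget_le_deg n i.1 i.2 (M.newGens_le a n i y.2).1.1.1

theorem newR_mem {a n : ℕ} {j : ℤ} {x : (M.newColl a).V n} (hx : x ∈ (M.newColl a).deg n j) :
    M.newR a n x ∈ H.deg n j := by
  refine lsum_mem_of_mem_fiberSubmodule (fun i hi y => ?_) hx
  rw [← hi]
  exact imageTarget_le_deg n i.1 i.2 (M.newGens_le a n i y.2).2

/-- The inclusion of the generators among the generators completed in arity `a`. -/
noncomputable abbrev incl (a : ℕ) : Decomposition.Map M.P (M.P.prod (M.newDecomp a)) :=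
  Decomposition.Map.inl _ _

/-- The data obtained by adding the new generators in arity `a`. -/
noncomputable def next (a : ℕ) : QuasiFreeData H where
  Z := M.Z.prod (M.newColl a)
  P := M.P.prod (M.newDecomp a)
  -- Old and new generators alike have their boundaries in the old free operad, so one inclusion
  -- transports both.
  δ n := (mapHom (M.incl a).toMap).map n ∘ₗ (M.δ n).coprod (M.newδ a n)
  δ_mem n j x hx := (mapHom (M.incl a).toMap).map_mem
    (Submodule.add_mem _ (M.δ_mem n j _ hx.1) (M.newδ_mem hx.2))
  δ_act n σ x := by
    refine Eq.trans ?_ ((mapHom (M.incl a).toMap).map_act σ _)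
    refine congrArg ((mapHom (M.incl a).toMap).map n) ?_
    change M.δ n (M.Z.act n σ x.1) + M.newδ a n ((M.newColl a).act n σ x.2) =
      M.F.act n σ (M.δ n x.1 + M.newδ a n x.2)
    rw [M.δ_act, M.newδ_act, map_add]
  r n := (M.r n).coprod (M.newR a n)
  r_mem n j x hx := Submodule.add_mem _ (M.r_mem n j _ hx.1) (M.newR_mem hx.2)
  r_act n σ x := by
    change M.r n (M.Z.act n σ x.1) + M.newR a n ((M.newColl a).act n σ x.2) =
      H.act n σ (M.r n x.1 + M.newR a n x.2)
    rw [M.r_act, M.newR_act, map_add]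

/-- The data without generators. -/
noncomputable def empty (H : Operad.{u, v} k) : QuasiFreeData H where
  Z := ofFamily (I := Empty) (fun _ _ => PUnit) (fun _ _ => 1) (fun _ => 0)
    fun _ _ _ => inferInstance
  P := ofFamilyDecomposition (I := Empty) (fun _ _ => PUnit) (fun _ _ => 1) (fun _ => 0)
    (fun _ => 0) fun _ _ _ => inferInstance
  δ _ := 0
  δ_mem _ _ _ _ := Submodule.zero_mem _
  δ_act _ _ _ := (map_zero _).symm
  r _ := 0
  r_mem _ _ _ _ := Submodule.zero_mem _
  r_act _ _ _ := (map_zero _).symm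

/-- The data with the generators of arity less than `n`. -/
noncomputable def stage (H : Operad.{u, v} k) : ℕ → QuasiFreeData H
  | 0 => empty H
  | n + 1 => (stage H n).next n

/-- Each step adds generators in a single arity. The case `m = n` is the decisive one: in arity `n`,
stage `n` has only decomposable elements. -/
theorem stage_subsingleton (n m : ℕ) (h : n ≤ m) : Subsingleton ((stage H n).Z.V m) := by
  induction n with
  | zero => exact ⟨fun x y => DFinsupp.ext fun i => i.elim⟩
  | succ n ih =>
    have h1 := ih (by omega)
    have h2 := (stage H n).newColl_subsingleton (show m ≠ n by omega)
    exact ⟨fun x y => Prod.ext (h1.elim _ _) (h2.elim _ _)⟩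

end QuasiFreeData

namespace QuasiFreeData

open FreeOperad Collection

variable {k : Type u} [Field k] [CharZero k] (H : Operad.{u, v} k)

/-! ### The limit -/

/-- The generators of all arities. -/
noncomputable abbrev limitColl : Collection.{u, max u v} k :=
  ofFamily (I := ℕ × (ℕ × ℤ)) (fun i n => (stage H i.1).newGens i.1 n i.2)
    (fun i n => (stage H i.1).newGensAct i.1 n i.2) (fun i => i.2.2)
    fun i _ hn => (stage H i.1).newGens_subsingleton (Or.inr hn) i.2

/-- The decomposition of the generators by the TJ-degree. -/
noncomputable abbrev limitDecomp : (limitColl H).Decomposition :=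
  ofFamilyDecomposition (I := ℕ × (ℕ × ℤ)) (fun i n => (stage H i.1).newGens i.1 n i.2)
    (fun i n => (stage H i.1).newGensAct i.1 n i.2) (fun i => i.2.1) (fun i => i.2.2)
    fun i _ hn => (stage H i.1).newGens_subsingleton (Or.inr hn) i.2

theorem mk_injective (a : ℕ) : Function.Injective (Prod.mk a : ℕ × ℤ → ℕ × (ℕ × ℤ)) :=
  Prod.mk_right_injective a

/-- The inclusion of the generators of arity `a`. -/
noncomputable def newToLimit (a : ℕ) :
    Decomposition.Map ((stage H a).newDecomp a) (limitDecomp H) :=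
  Decomposition.Map.extend (I := ℕ × (ℕ × ℤ)) (fun i n => (stage H i.1).newGens i.1 n i.2)
    (fun i n => (stage H i.1).newGensAct i.1 n i.2) (fun i => i.2.1) (fun i => i.2.2)
    (fun i _ hn => (stage H i.1).newGens_subsingleton (Or.inr hn) i.2) (Prod.mk a)

/-- The projection onto the generators of arity `a`. -/
noncomputable def limitToNew (a : ℕ) :
    Decomposition.Map (limitDecomp H) ((stage H a).newDecomp a) :=
  Decomposition.Map.restrict (I := ℕ × (ℕ × ℤ)) (fun i n => (stage H i.1).newGens i.1 n i.2)
    (fun i n => (stage H i.1).newGensAct i.1 n i.2) (fun i => i.2.1) (fun i => i.2.2)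
    (fun i _ hn => (stage H i.1).newGens_subsingleton (Or.inr hn) i.2) (Prod.mk a)
    (mk_injective a)

theorem limitToNew_newToLimit (a n : ℕ) (x : ((stage H a).newColl a).V n) :
    (limitToNew H a).map n ((newToLimit H a).map n x) = x :=
  Decomposition.Map.restrict_extend (I := ℕ × (ℕ × ℤ))
    (fun i n => (stage H i.1).newGens i.1 n i.2)
    (fun i n => (stage H i.1).newGensAct i.1 n i.2) (fun i => i.2.1) (fun i => i.2.2)
    (fun i _ hn => (stage H i.1).newGens_subsingleton (Or.inr hn) i.2) (Prod.mk a)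
    (mk_injective a) n x

/-- Restricted to arity `a`, because there the summands of the limit with another first index
vanish. -/
theorem newToLimit_limitToNew (a : ℕ) (x : (limitColl H).V a) :
    (newToLimit H a).map a ((limitToNew H a).map a x) = x :=
  Decomposition.Map.extend_restrict (I := ℕ × (ℕ × ℤ))
    (fun i n => (stage H i.1).newGens i.1 n i.2)
    (fun i n => (stage H i.1).newGensAct i.1 n i.2) (fun i => i.2.1) (fun i => i.2.2)
    (fun i _ hn => (stage H i.1).newGens_subsingleton (Or.inr hn) i.2) (Prod.mk a)
    (mk_injective a) a (fun i hi => (stage H i.1).newGens_subsingleton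
      (Or.inl fun h => hi ⟨i.2, Prod.ext h rfl⟩) i.2) x

/-- The inclusion of the generators of arity less than `n`. -/
noncomputable def toLimit : ∀ n, Decomposition.Map (stage H n).P (limitDecomp H)
  | 0 => Decomposition.Map.zero _ _
  | n + 1 => (toLimit n).coprod (newToLimit H n)

/-- The projection onto the generators of arity less than `n`. -/
noncomputable def ofLimit : ∀ n, Decomposition.Map (limitDecomp H) (stage H n).P
  | 0 => Decomposition.Map.zero _ _
  | n + 1 => (ofLimit n).prodMk (limitToNew H n)

theorem toLimit_succ (n m : ℕ) (x : (stage H n).Z.V m) (y : ((stage H n).newColl n).V m) :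
    (toLimit H (n + 1)).map m (x, y) = (toLimit H n).map m x + (newToLimit H n).map m y := rfl

theorem ofLimit_succ (n m : ℕ) (x : (limitColl H).V m) :
    (ofLimit H (n + 1)).map m x = ((ofLimit H n).map m x, (limitToNew H n).map m x) := rfl

/-- In any arity at most one of the two summands of stage `n + 1` is nonzero: the new one in arity
`n`, the old one elsewhere. The mixed terms therefore vanish. This retraction makes `freeToLimit`
injective. -/
theorem ofLimit_toLimit (n m : ℕ) (x : (stage H n).Z.V m) :
    (ofLimit H n).map m ((toLimit H n).map m x) = x := by
  induction n with
  | zero => exact (stage_subsingleton 0 m (Nat.zero_le m)).elim _ _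
  | succ n ih =>
    obtain ⟨x, y⟩ := x
    rw [toLimit_succ, ofLimit_succ, map_add, map_add]
    by_cases h : m = n
    · subst h
      have := stage_subsingleton (H := H) m m le_rfl
      rw [Subsingleton.elim x 0, map_zero, map_zero, map_zero, limitToNew_newToLimit, zero_add,
        zero_add]
      exact Prod.ext (Subsingleton.elim _ _) rfl
    · have := (stage H n).newColl_subsingleton h
      rw [Subsingleton.elim y 0, map_zero, map_zero, add_zero, ih]
      exact Prod.ext rfl (Subsingleton.elim _ _)

/-- A generator of arity `m` enters at stage `m + 1`, hence is present at every stage `n > m`. This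
is the section required by `tjDeg_le_map_sup`. -/
theorem toLimit_ofLimit (n m : ℕ) (h : m < n) (x : (limitColl H).V m) :
    (toLimit H n).map m ((ofLimit H n).map m x) = x := by
  induction n with
  | zero => omega
  | succ n ih =>
    rw [ofLimit_succ, toLimit_succ]
    by_cases hm : m = n
    · subst hm
      have := stage_subsingleton (H := H) m m le_rfl
      rw [newToLimit_limitToNew, Subsingleton.elim ((ofLimit H m).map m x) 0, map_zero, zero_add]
    · have := (stage H n).newColl_subsingleton hm
      rw [ih (by omega), Subsingleton.elim ((limitToNew H n).map m x) 0, map_zero, add_zero]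

/-- The homomorphism of free operads induced by the inclusion of the generators of arity less
than `n`. -/
noncomputable abbrev freeToLimit (n : ℕ) :
    Operad.Hom (freeOperad (stage H n).Z) (freeOperad (limitColl H)) :=
  mapHom (toLimit H n).toMap

theorem freeToLimit_injective (n m : ℕ) : Function.Injective ((freeToLimit H n).map m) :=
  mapHom_injective _ (ofLimit H n).toMap (ofLimit_toLimit H n) m

/-- Compatibility of the inclusions of successive stages. It matches the transport of boundaries in
`next` with the boundaries in the limit. -/
theorem freeToLimit_incl (n m : ℕ) (x : (stage H n).F.V m) :
    (freeToLimit H (n + 1)).map m ((mapHom ((stage H n).incl n).toMap).map m x) =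
      (freeToLimit H n).map m x :=
  mapHom_mapHom _ _ _ (fun m z => by
    refine (toLimit_succ H n m z 0).trans ?_
    rw [map_zero, add_zero]) x

/-- The boundaries of a generator. -/
noncomputable def limitδ (n : ℕ) : (limitColl H).V n →ₗ[k] (freeOperad (limitColl H)).V n :=
  DFinsupp.lsum ℕ fun i => (freeToLimit H i.1).map n ∘ₗ LinearMap.fst k _ _ ∘ₗ
    ((stage H i.1).newGens i.1 n i.2).subtype

/-- The image in `H` of a generator. -/
noncomputable def limitR (n : ℕ) : (limitColl H).V n →ₗ[k] H.V n :=
  DFinsupp.lsum ℕ fun i => LinearMap.snd k _ _ ∘ₗ ((stage H i.1).newGens i.1 n i.2).subtype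

theorem limitδ_mem (n : ℕ) (j : ℤ) (x : (limitColl H).V n) (hx : x ∈ (limitColl H).deg n j) :
    limitδ H n x ∈ (freeOperad (limitColl H)).deg n (j + -1) := by
  refine lsum_mem_of_mem_fiberSubmodule (fun i hi y => ?_) hx
  have := (freeToLimit H i.1).map_mem ((stage H i.1).boundaryTarget_le_deg n i.2.1 i.2.2
    ((stage H i.1).newGens_le i.1 n i.2 y.2).1.1.1)
  rw [hi] at this
  exact this

theorem limitR_mem (n : ℕ) (j : ℤ) (x : (limitColl H).V n) (hx : x ∈ (limitColl H).deg n j) :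
    limitR H n x ∈ H.deg n j := by
  refine lsum_mem_of_mem_fiberSubmodule (fun i hi y => ?_) hx
  have := imageTarget_le_deg n i.2.1 i.2.2 ((stage H i.1).newGens_le i.1 n i.2 y.2).2
  rw [hi] at this
  exact this

theorem limitδ_act (n : ℕ) (σ : Perm (Fin n)) (x : (limitColl H).V n) :
    limitδ H n ((limitColl H).act n σ x) =
      (freeOperad (limitColl H)).act n σ (limitδ H n x) :=
  lsum_mapRange (fun i : ℕ × (ℕ × ℤ) => (freeToLimit H i.1).map n ∘ₗ LinearMap.fst k _ _ ∘ₗ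
    ((stage H i.1).newGens i.1 n i.2).subtype) (fun i => (stage H i.1).newGensAct i.1 n i.2 σ)
    ((freeOperad (limitColl H)).act n σ) (fun i y => (freeToLimit H i.1).map_act σ y.1.1) x

theorem limitR_act (n : ℕ) (σ : Perm (Fin n)) (x : (limitColl H).V n) :
    limitR H n ((limitColl H).act n σ x) = H.act n σ (limitR H n x) :=
  lsum_mapRange (fun i : ℕ × (ℕ × ℤ) => LinearMap.snd k _ _ ∘ₗ
    ((stage H i.1).newGens i.1 n i.2).subtype) (fun i => (stage H i.1).newGensAct i.1 n i.2 σ)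
    (H.act n σ) (fun _ _ => rfl) x

/-- The derivation of the free operad on the generators of all arities. -/
noncomputable def limitD : Operad.Derivation (freeOperad (limitColl H)) (-1) :=
  derivation (limitδ H) (limitδ_mem H) (limitδ_act H)

/-- The homomorphism from the free operad on the generators of all arities. -/
noncomputable def limitρ : Operad.Hom (freeOperad (limitColl H)) H :=
  lift (limitR H) (limitR_mem H) (limitR_act H)

@[simp] theorem limitD_ι (n : ℕ) (z : (limitColl H).V n) :
    (limitD H).map n (ι (limitColl H) n z) = limitδ H n z :=
  derivation_ι _ _ _ n z

@[simp] theorem limitρ_ι (n : ℕ) (z : (limitColl H).V n) :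
    (limitρ H).map n (ι (limitColl H) n z) = limitR H n z :=
  lift_ι _ _ _ n z

theorem limitδ_newToLimit (a n : ℕ) (x : ((stage H a).newColl a).V n) :
    limitδ H n ((newToLimit H a).map n x) = (freeToLimit H a).map n ((stage H a).newδ a n x) := by
  refine (DFinsupp.lsum_extendLin (Prod.mk a) (fun i : ℕ × (ℕ × ℤ) =>
    (freeToLimit H i.1).map n ∘ₗ LinearMap.fst k _ _ ∘ₗ
      ((stage H i.1).newGens i.1 n i.2).subtype) x).trans ?_
  exact (DFinsupp.map_lsum ((freeToLimit H a).map n) _ x).symm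

theorem limitR_newToLimit (a n : ℕ) (x : ((stage H a).newColl a).V n) :
    limitR H n ((newToLimit H a).map n x) = (stage H a).newR a n x :=
  DFinsupp.lsum_extendLin (Prod.mk a) (fun i : ℕ × (ℕ × ℤ) =>
    LinearMap.snd k _ _ ∘ₗ ((stage H i.1).newGens i.1 n i.2).subtype) x

/-- Passing to the next stage does not alter the boundaries already chosen, so the boundary in the
limit can be computed at any stage containing the generator. -/
theorem limitδ_toLimit (n m : ℕ) (x : (stage H n).Z.V m) :
    limitδ H m ((toLimit H n).map m x) = (freeToLimit H n).map m ((stage H n).δ m x) := by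
  induction n with
  | zero =>
    have := stage_subsingleton (H := H) 0 m (Nat.zero_le m)
    rw [Subsingleton.elim x 0]
    simp only [map_zero]
  | succ n ih =>
    obtain ⟨x, y⟩ := x
    rw [toLimit_succ, map_add, ih, limitδ_newToLimit, ← map_add]
    exact (freeToLimit_incl H n m _).symm

theorem limitR_toLimit (n m : ℕ) (x : (stage H n).Z.V m) :
    limitR H m ((toLimit H n).map m x) = (stage H n).r m x := by
  induction n with
  | zero =>
    have := stage_subsingleton (H := H) 0 m (Nat.zero_le m)
    rw [Subsingleton.elim x 0]
    simp only [map_zero]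
  | succ n ih =>
    obtain ⟨x, y⟩ := x
    rw [toLimit_succ, map_add, ih, limitR_newToLimit]
    rfl

theorem limitD_freeToLimit (n m : ℕ) (x : (stage H n).F.V m) :
    (limitD H).map m ((freeToLimit H n).map m x) =
      (freeToLimit H n).map m ((stage H n).d.map m x) :=
  (hom_comm_derivation (freeToLimit H n) (stage H n).d (limitD H) (fun m z => by
    rw [d_ι, mapHom_ι, limitD_ι, limitδ_toLimit]) x).symm

theorem limitρ_freeToLimit (n m : ℕ) (x : (stage H n).F.V m) :
    (limitρ H).map m ((freeToLimit H n).map m x) = (stage H n).ρ.map m x :=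
  hom_ext_ι (φ := (limitρ H).comp (freeToLimit H n)) (ψ := (stage H n).ρ) (fun m z => by
    rw [ρ_ι, ← limitR_toLimit, ← limitρ_ι, ← mapHom_ι]
    rfl) x

end QuasiFreeData

/-- Homomorphisms commute with the projections onto the homogeneous components. -/
theorem Operad.Hom.map_proj {k : Type u} [Field k] {S : Operad.{u, v} k} {T : Operad.{u, w} k}
    (φ : Operad.Hom S T) (n : ℕ) (j : ℤ) (x : S.V n) :
    φ.map n (S.proj n j x) = T.proj n j (φ.map n x) := by
  have : φ.map n ∘ₗ S.proj n j = T.proj n j ∘ₗ φ.map n := by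
    refine S.hom_ext_of_deg fun i x hx => ?_
    rw [LinearMap.comp_apply, LinearMap.comp_apply, S.proj_of_mem j hx,
      T.proj_of_mem j (φ.map_mem hx)]
    split_ifs
    · rfl
    · exact map_zero _
  exact LinearMap.congr_fun this x

namespace QuasiFreeData

open FreeOperad Collection

variable {k : Type u} [Field k] [CharZero k] (H : Operad.{u, v} k)

/-! ### Properties of the limit -/

/-- The boundary of a generator was chosen among the cycles of its stage, and `freeToLimit` commutes
with the derivations. Only the limit derivation is shown to have square zero; the argument does not
need this for the stages. -/
theorem d_limitδ (n : ℕ) (z : (limitColl H).V n) : (limitD H).map n (limitδ H n z) = 0 := by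
  refine lsum_mem (S := LinearMap.ker ((limitD H).map n)) (fun i y => ?_) z
  have h0 : (stage H i.1).d.map n y.1.1 = 0 := ((stage H i.1).newGens_le i.1 n i.2 y.2).1.1.2
  refine (limitD_freeToLimit H i.1 n y.1.1).trans ?_
  exact (congrArg ((freeToLimit H i.1).map n) h0).trans (map_zero _)

theorem ρ_limitδ (n : ℕ) (z : (limitColl H).V n) : (limitρ H).map n (limitδ H n z) = 0 := by
  refine lsum_mem (S := LinearMap.ker ((limitρ H).map n)) (fun i y => ?_) z
  have h0 : (stage H i.1).ρ.map n y.1.1 = 0 := ((stage H i.1).newGens_le i.1 n i.2 y.2).1.2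
  exact (limitρ_freeToLimit H i.1 n y.1.1).trans h0

theorem limitδ_eq_zero {n : ℕ} {z : (limitColl H).V n} (hz : z ∈ (limitDecomp H).piece 0 n) :
    limitδ H n z = 0 := by
  refine (Submodule.mem_bot k).1
    (lsum_mem_of_mem_fiberSubmodule (S := (⊥ : Submodule k _)) (fun i hi y => ?_) hz)
  obtain ⟨a, l, j⟩ := i
  obtain rfl : l = 0 := hi
  have h0 : y.1.1 = 0 := ((stage H a).newGens_le a n (0, j) y.2).1.1.1
  refine (Submodule.mem_bot k).2 (Eq.trans (congrArg ((freeToLimit H a).map n) h0) (map_zero _))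

theorem limitδ_mem_tjPiece {l n : ℕ} {z : (limitColl H).V n}
    (hz : z ∈ (limitDecomp H).piece (l + 1) n) :
    limitδ H n z ∈ tjPiece (limitDecomp H) l n := by
  refine lsum_mem_of_mem_fiberSubmodule (fun i hi y => ?_) hz
  obtain ⟨a, l', j⟩ := i
  obtain rfl : l' = l + 1 := hi
  exact tjDeg_le_tjPiece l (j + -1) n (mapHom_mem_tjDeg (fun h => (toLimit H a).map_piece h)
    ((stage H a).newGens_le a n (l + 1, j) y.2).1.1.1)

theorem limitR_eq_zero {l n : ℕ} {z : (limitColl H).V n}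
    (hz : z ∈ (limitDecomp H).piece (l + 1) n) : limitR H n z = 0 := by
  refine (Submodule.mem_bot k).1
    (lsum_mem_of_mem_fiberSubmodule (S := (⊥ : Submodule k _)) (fun i hi y => ?_) hz)
  obtain ⟨a, l', j⟩ := i
  obtain rfl : l' = l + 1 := hi
  exact ((stage H a).newGens_le a n (l + 1, j) y.2).2

/-- The boundary of a generator of arity `n` comes from stage `n`, which has no generators of arity
`n`. In that arity every element of the stage is thus decomposable. -/
theorem limitδ_mem_lengthGE (n : ℕ) (z : (limitColl H).V n) :
    limitδ H n z ∈ lengthGE (limitColl H) 2 n := by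
  refine lsum_mem (fun i y => ?_) z
  by_cases h : n = i.1
  · exact hom_mem_lengthGE_two (freeToLimit H i.1) (stage_subsingleton i.1 n h.ge) y.1.1
  · have := (stage H i.1).newGens_subsingleton (Or.inl h) i.2
    rw [Subsingleton.elim y 0, map_zero]
    exact Submodule.zero_mem _

/-- The differential of the model. -/
noncomputable def limitDifferential : (freeOperad (limitColl H)).Differential where
  toDerivation := (limitD H)
  map_map := derivation_sq_eq_zero (limitD H) fun n z =>
    (congrArg ((limitD H).map n) (limitD_ι H n z)).trans (d_limitδ H n z)

theorem ρ_d_eq_zero (n : ℕ) (x : (freeOperad (limitColl H)).V n) :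
    (limitρ H).map n ((limitD H).map n x) = 0 :=
  hom_derivation_eq_zero (limitρ H) (limitD H) (fun n z =>
    (congrArg ((limitρ H).map n) (limitD_ι H n z)).trans (ρ_limitδ H n z)) x

theorem limitδ_single (m : ℕ) (i : ℕ × (ℕ × ℤ)) (c : (stage H i.1).newGens i.1 m i.2) :
    limitδ H m (DFinsupp.single i c : Π₀ i : ℕ × (ℕ × ℤ), (stage H i.1).newGens i.1 m i.2) =
      (freeToLimit H i.1).map m c.1.1 :=
  DFinsupp.lsum_single ℕ (fun i : ℕ × (ℕ × ℤ) => (freeToLimit H i.1).map m ∘ₗ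
    LinearMap.fst k _ _ ∘ₗ ((stage H i.1).newGens i.1 m i.2).subtype) i c

theorem limitR_single (m : ℕ) (i : ℕ × (ℕ × ℤ)) (c : (stage H i.1).newGens i.1 m i.2) :
    limitR H m (DFinsupp.single i c : Π₀ i : ℕ × (ℕ × ℤ), (stage H i.1).newGens i.1 m i.2) =
      c.1.2 :=
  DFinsupp.lsum_single ℕ (fun i : ℕ × (ℕ × ℤ) => LinearMap.snd k _ _ ∘ₗ
    ((stage H i.1).newGens i.1 m i.2).subtype) i c

theorem exists_limit_gen (m : ℕ) (i : ℕ × ℤ) {c : (stage H m).F.V m × H.V m}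
    (hc : c ∈ (stage H m).newGens m m i) :
    ∃ z : (limitColl H).V m, limitδ H m z = (freeToLimit H m).map m c.1 ∧
      limitR H m z = c.2 :=
  ⟨_, limitδ_single H m (m, i) ⟨c, hc⟩, limitR_single H m (m, i) ⟨c, hc⟩⟩

/-- The arity fixes the first index and the two gradings fix the others, so a bihomogeneous
generator lives in the single summand `(m, (l, j))`. It is then determined by its pair `c`. -/
theorem exists_newGen {m l : ℕ} {j : ℤ} {z : (limitColl H).V m}
    (hl : z ∈ (limitDecomp H).piece l m) (hj : z ∈ (limitColl H).deg m j) :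
    ∃ c ∈ (stage H m).newGens m m (l, j), limitδ H m z = (freeToLimit H m).map m c.1 ∧
      limitR H m z = c.2 ∧ (c = 0 → z = 0) := by
  let z' : Π₀ i : ℕ × (ℕ × ℤ), (stage H i.1).newGens i.1 m i.2 := z
  have hz : z' = DFinsupp.single (m, (l, j)) (z' (m, (l, j))) := by
    ext1 i
    by_cases hi : i = (m, (l, j))
    · subst hi
      rw [DFinsupp.single_eq_same]
    · rw [DFinsupp.single_eq_of_ne hi]
      by_cases h1 : i.1 = m
      · by_cases h2 : i.2.1 = l
        · exact hj i fun h3 => hi (Prod.ext h1 (Prod.ext h2 h3))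
        · exact hl i h2
      · have := (stage H i.1).newGens_subsingleton (Or.inl (Ne.symm h1)) i.2
        exact Subsingleton.elim _ _
  refine ⟨(z' (m, (l, j))).1, (z' (m, (l, j))).2, ?_, ?_, fun h => ?_⟩
  · exact (congrArg (limitδ H m) hz).trans (limitδ_single H m (m, (l, j)) _)
  · exact (congrArg (limitR H m) hz).trans (limitR_single H m (m, (l, j)) _)
  · have h0 : z' (m, (l, j)) = 0 := Subtype.ext h
    rw [h0, DFinsupp.single_zero] at hz
    exact hz

/-- A homogeneous cycle that `ρ` kills is a boundary. -/
theorem exists_d_eq_of_mem_tjDeg {m l : ℕ} {j : ℤ} {x : (freeOperad (limitColl H)).V m}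
    (hx : x ∈ tjDeg (limitDecomp H) l j m) (hd : (limitD H).map m x = 0)
    (hρ : (limitρ H).map m x = 0) : ∃ y, (limitD H).map m y = x := by
  by_cases hm : m < 2
  · exact ⟨0, (map_zero _).trans (eq_zero_of_lt_two hm x).symm⟩
  -- Split the cycle into a generator `z` of arity `m` and an element `w` of stage `m`.
  obtain ⟨_, ⟨z, ⟨hzl, hzj⟩, rfl⟩, _, ⟨w, hw, rfl⟩, rfl⟩ := Submodule.mem_sup.1
    (tjDeg_le_map_sup (toLimit H m).toMap (ofLimit H m).toMap
      (fun h => (ofLimit H m).map_piece h) (fun n hn => toLimit_ofLimit H m n hn) l j hx)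
  obtain ⟨c, hc, hcδ, hcr, hcz⟩ := exists_newGen H hzl hzj
  have h1 : c.1 + (stage H m).d.map m w = 0 := by
    apply freeToLimit_injective H m m
    rw [map_add, map_zero, ← hcδ, ← limitD_freeToLimit, ← limitD_ι, ← map_add]
    exact hd
  have h2 : c.2 + (stage H m).ρ.map m w = 0 := by
    rw [← hcr, ← limitρ_freeToLimit, ← limitρ_ι, ← map_add]
    exact hρ
  -- The two vanishing conditions say that `c` is the image of `-w` under the cone map, whereas `c`
  -- belongs to a complement of the range.
  have hc0 : c = 0 := by
    refine (stage H m).eq_zero_of_mem_newGens hc ⟨-w, Prod.ext ?_ ?_⟩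
    · exact (map_neg ((stage H m).d.map m) w).trans (neg_eq_of_add_eq_zero_left h1)
    · exact (map_neg ((stage H m).ρ.map m) w).trans (neg_eq_of_add_eq_zero_left h2)
  rw [hcz hc0, map_zero, zero_add]
  rw [hc0] at h1 h2
  -- What remains is a cycle killed by `ρ`. A generator bounding it has TJ-degree and inner degree
  -- larger by one.
  have hmem : (w, (0 : H.V m)) ∈ (stage H m).coneCycles m (l + 1, j + 1) := by
    refine ⟨⟨⟨?_, (zero_add _).symm.trans h1⟩, (zero_add _).symm.trans h2⟩, Submodule.zero_mem _⟩
    change w ∈ tjDeg (stage H m).P l (j + 1 + -1) m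
    rwa [add_neg_cancel_right]
  obtain ⟨_, ⟨y, rfl⟩, c', hc', hsum⟩ := Submodule.mem_sup.1
    ((stage H m).coneCycles_le m (by omega) _ hmem)
  obtain ⟨z', hz', -⟩ := exists_limit_gen H m _ hc'
  -- The cone boundary of `y` and the pair of `z'` add up to `(w, 0)`; only the first components
  -- matter here, so `y` need not be homogeneous.
  refine ⟨(freeToLimit H m).map m y + ι (limitColl H) m z', ?_⟩
  rw [map_add, limitD_freeToLimit, limitD_ι, hz', ← map_add]
  exact congrArg ((freeToLimit H m).map m) (congrArg Prod.fst hsum)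

/-- In arity at least two, a homogeneous `h` gives the cone cycle `(0, h)` of TJ-degree zero, which
is a cone boundary plus a new generator; second components give a preimage. In arities zero and one
the target vanishes, in arity one by hypothesis. -/
theorem ρ_surjective (hH : Subsingleton (H.V 1)) (m : ℕ) :
    Function.Surjective ((limitρ H).map m) := by
  rw [← LinearMap.range_eq_top, eq_top_iff, ← H.iSup_deg m]
  refine iSup_le fun j h hh => ?_
  by_cases hm : m < 2
  · have : Subsingleton (H.V m) := by
      interval_cases m
      · exact H.subsingleton_zero
      · exact hH
    rw [Subsingleton.elim h 0]
    exact Submodule.zero_mem _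
  have hmem : ((0 : (stage H m).F.V m), h) ∈ (stage H m).coneCycles m (0, j) :=
    ⟨Submodule.zero_mem _, hh⟩
  obtain ⟨_, ⟨y, rfl⟩, c, hc, hsum⟩ := Submodule.mem_sup.1
    ((stage H m).coneCycles_le m (by omega) _ hmem)
  obtain ⟨z, -, hz⟩ := exists_limit_gen H m _ hc
  refine ⟨(freeToLimit H m).map m y + ι (limitColl H) m z, ?_⟩
  rw [map_add, limitρ_freeToLimit, limitρ_ι, hz]
  exact congrArg Prod.snd hsum

theorem ρ_eq_zero_of_mem_tjPiece {l n : ℕ} (hl : 1 ≤ l) {x : (freeOperad (limitColl H)).V n}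
    (hx : x ∈ tjPiece (limitDecomp H) l n) : (limitρ H).map n x = 0 := by
  obtain ⟨l, rfl⟩ := Nat.exists_eq_add_of_le' hl
  refine SymSeq.mem_of_proj_mem _ (LinearMap.ker ((limitρ H).map n)) x fun j => ?_
  exact hom_eq_zero_of_tj_pos (limitρ H)
    (fun hz => (limitρ_ι H _ _).trans (limitR_eq_zero H hz)) (proj_mem_tjDeg j hx)

theorem d_eq_zero_of_mem_tjPiece {n : ℕ} {x : (freeOperad (limitColl H)).V n}
    (hx : x ∈ tjPiece (limitDecomp H) 0 n) : (limitD H).map n x = 0 := by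
  refine SymSeq.mem_of_proj_mem _ (LinearMap.ker ((limitD H).map n)) x fun j => ?_
  exact derivation_eq_zero_of_tj_zero (limitD H)
    (fun hz => (limitD_ι H _ _).trans (limitδ_eq_zero H hz)) (proj_mem_tjDeg j hx)

/-- A cycle of fixed TJ-degree that `ρ` kills is a boundary. -/
theorem exists_d_eq_of_mem_tjPiece {m l : ℕ} {x : (freeOperad (limitColl H)).V m}
    (hx : x ∈ tjPiece (limitDecomp H) l m) (hd : (limitD H).map m x = 0)
    (hρ : (limitρ H).map m x = 0) : ∃ y, (limitD H).map m y = x := by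
  -- Boundaries form a subspace, so the homogeneous components may be treated separately; each of
  -- them is again a cycle killed by `ρ`.
  refine SymSeq.mem_of_proj_mem _ (LinearMap.range ((limitD H).map m)) x fun j => ?_
  refine exists_d_eq_of_mem_tjDeg H (proj_mem_tjDeg j hx) ?_ ?_
  · exact (limitDifferential H).proj_mem_cycles j hd
  · rw [(limitρ H).map_proj, hρ, map_zero]

/-- The components of positive TJ-degree of any preimage can be dropped, since `ρ` kills them. -/
theorem exists_tjPiece_zero_ρ_eq (hH : Subsingleton (H.V 1)) {m : ℕ} (h : H.V m) :
    ∃ x ∈ tjPiece (limitDecomp H) 0 m, (limitρ H).map m x = h := by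
  obtain ⟨x, rfl⟩ := ρ_surjective H hH m h
  have : ⨆ i : ℕ × ℤ, tjDeg (limitDecomp H) i.1 i.2 m ≤
      ((tjPiece (limitDecomp H) 0 m).map ((limitρ H).map m)).comap ((limitρ H).map m) := by
    refine iSup_le fun i x hx => ?_
    obtain ⟨_ | l, j⟩ := i
    · exact ⟨x, tjDeg_le_tjPiece _ _ _ hx, rfl⟩
    · refine ⟨0, Submodule.zero_mem _, ?_⟩
      rw [map_zero]
      exact (ρ_eq_zero_of_mem_tjPiece H (Nat.le_add_left 1 l) (tjDeg_le_tjPiece _ _ _ hx)).symm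
  rw [iSup_tjDeg] at this
  exact this Submodule.mem_top

end QuasiFreeData

/-! ### The main theorem -/

open QuasiFreeData in
theorem mainTheorem4 {k : Type u} [Field k] [CharZero k] (H : Operad.{u, v} k)
    (hH : Subsingleton (H.V 1)) :
    ∃ (Z : Collection.{u, max u v} k) (P : Z.Decomposition)
      (d : (freeOperad Z).Differential) (ρ : Operad.Hom (freeOperad Z) H)
      (hρ : ρ.Commutes d H.zeroDifferential),
      -- the differential lowers the TJ-degree by one
      (∀ n, ∀ z ∈ P.piece 0 n, d.map n (FreeOperad.ι Z n z) = 0) ∧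
      (∀ l n, ∀ z ∈ P.piece (l + 1) n,
        d.map n (FreeOperad.ι Z n z) ∈ FreeOperad.tjPiece P l n) ∧
      -- the differential is minimal
      (∀ n, ∀ z : Z.V n, d.map n (FreeOperad.ι Z n z) ∈ FreeOperad.lengthGE Z 2 n) ∧
      -- `ρ` vanishes on the generators of positive TJ-degree
      (∀ l ≥ 1, ∀ n, ∀ z ∈ P.piece l n, ρ.map n (FreeOperad.ι Z n z) = 0) ∧
      -- `ρ` induces an isomorphism from the homology in TJ-degree zero
      (∀ n, Function.Bijective
        (((ρ.homologyDesc d hρ).map n).domRestrict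
          (d.homologyPiece (FreeOperad.tjPiece P 0 n)))) ∧
      -- the homology in positive TJ-degrees vanishes
      (∀ l ≥ 1, ∀ n, d.homologyPiece (FreeOperad.tjPiece P l n) = ⊥) := by
  have hι : ∀ n z, (limitDifferential H).map n (FreeOperad.ι (limitColl H) n z) =
      limitδ H n z := limitD_ι H
  refine ⟨limitColl H, limitDecomp H, limitDifferential H, (limitρ H), ρ_d_eq_zero H,
    fun n z hz => ?_, fun l n z hz => ?_, fun n z => ?_, fun l hl n z hz => ?_,
    fun n => ⟨?_, fun h => ?_⟩, fun l hl n => ?_⟩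
  · rw [hι]
    exact limitδ_eq_zero H hz
  · rw [hι]
    exact limitδ_mem_tjPiece H hz
  · rw [hι]
    exact limitδ_mem_lengthGE H n z
  · obtain ⟨l, rfl⟩ := Nat.exists_eq_add_of_le' hl
    exact (limitρ_ι H n z).trans (limitR_eq_zero H hz)
  · rintro ⟨_, x, hx, rfl⟩ ⟨_, y, hy, rfl⟩ hxy
    -- Injectivity: the difference of two representing cycles has TJ-degree zero and is killed by
    -- `ρ`, hence is a boundary.
    refine Subtype.ext (sub_eq_zero.1 ?_)
    refine (map_sub ((limitDifferential H).cls n) x y).symm.trans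
      ((limitDifferential H).cls_eq_zero.2 ?_)
    refine exists_d_eq_of_mem_tjPiece H (Submodule.sub_mem _ hx hy) (x - y).2 ?_
    exact (map_sub ((limitρ H).map n) x.1 y.1).trans (sub_eq_zero.2 hxy)
  -- Surjectivity: a preimage of TJ-degree zero is automatically a cycle.
  · obtain ⟨x, hx, rfl⟩ := exists_tjPiece_zero_ρ_eq H hH h
    exact ⟨⟨_, ⟨x, d_eq_zero_of_mem_tjPiece H hx⟩, hx, rfl⟩, rfl⟩
  · rw [eq_bot_iff]
    rintro _ ⟨x, hx, rfl⟩
    -- In positive TJ-degree the condition that `ρ` kills the cycle holds automatically.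
    exact (Submodule.mem_bot k).2 ((limitDifferential H).cls_eq_zero.2
      (exists_d_eq_of_mem_tjPiece H hx x.2 (ρ_eq_zero_of_mem_tjPiece H hl hx)))
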